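/- Let $p\in\mathbb R$ with $p>3$ and put $\kappa_p=\frac{2(p+1)}{(p-1)^2}$. Let $H^1(0,1)$ be the Sobolev space of complex-valued functions with norm $\|u\|_{H^1}^2=\int_0^1|u|^2\,d\rho+\int_0^1|u'|^2\,d\rho$, and let $\mathcal H=\{u\in H^1(0,1):u(0)=0\}\times H^1(0,1)$ with norm $\|(u_1,u_2)\|^2=\|u_1\|_{H^1}^2+\|u_2\|_{H^1}^2$. Let $L_0$ be the closure in $\mathcal H$ of the (closable) operator $$\tilde L_0\begin{pmatrix}u_1\\u_2\end{pmatrix}(\rho)=\begin{pmatrix}u_2'(\rho)-\rho u_1'(\rho)\\u_1'(\rho)-\rho u_2'(\rho)\end{pmatrix}-\frac{2}{p-1}\begin{pmatrix}u_1(\rho)\\u_2(\rho)\end{pmatrix}$$ with domain $\{(u_1,u_2)\in C^2[0,1]\times C^2[0,1]:u_1(0)=0,\ u_2'(0)=0\}$. Let $L'(u_1,u_2)(\rho)=\bigl(p\kappa_p\int_0^\rho u_2(s)\,ds,\ 0\bigr)$ on $\mathcal H$, and let $L=L_0+L'$ with domain $\mathcal D(L)=\mathcal D(L_0)$. Then the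 spectrum of $L$ satisfies $$\sigma(L)\subseteq\Bigl\{\lambda\in\mathbb C:\operatorname{Re}\lambda\le-\frac{2}{p-1}\Bigr\}\cup\{1\}.$$ Moreover, $1\in\sigma(L)$ is an eigenvalue of $L$, and its geometric eigenspace $\ker(1-L)$ is one-dimensional and spanned by the symmetry mode $$g(\rho)=\begin{pmatrix}\frac{p+1}{p-1}\,\rho\\1\end{pmatrix}.$$ -/

import Mathlib

open Set MeasureTheory
open scoped ContDiff

noncomputable section

namespace BlowupStability

/-! ### Spectrum of a partially defined operator -/

section Operators

variable {E : Type*} [NormedAddCommGroup E] [NormedSpace ℂ E]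

/-- The resolvent set of `A : D(A) ⊆ E → E`: the `z` for which `z - A : D(A) → E` is a bijection
with bounded (everywhere defined) inverse `R`. -/
def resolventSetOp (A : E →ₗ.[ℂ] E) : Set ℂ :=
  {z | ∃ R : E →L[ℂ] E,
    (∀ f : E, ∃ h : R f ∈ A.domain, z • R f - A ⟨R f, h⟩ = f) ∧
    (∀ u : A.domain, R (z • (u : E) - A u) = u)}

/-- The spectrum `σ(A)`. -/
def spectrumOp (A : E →ₗ.[ℂ] E) : Set ℂ := (resolventSetOp A)ᶜ

/-- The geometric eigenspace `ker (z - A)`, as a subspace of `E`. -/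
def eigenspaceOp (A : E →ₗ.[ℂ] E) (z : ℂ) : Submodule ℂ E where
  carrier := {u | ∃ h : u ∈ A.domain, A ⟨u, h⟩ = z • u}
  zero_mem' := ⟨A.domain.zero_mem, by
    have : (⟨0, A.domain.zero_mem⟩ : A.domain) = 0 := rfl
    rw [this, A.map_zero, smul_zero]⟩
  add_mem' := by
    rintro u v ⟨hu, hu'⟩ ⟨hv, hv'⟩
    refine ⟨A.domain.add_mem hu hv, ?_⟩
    have : (⟨u + v, A.domain.add_mem hu hv⟩ : A.domain) = ⟨u, hu⟩ + ⟨v, hv⟩ := rfl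
    rw [this, A.map_add, hu', hv', smul_add]
  smul_mem' := by
    rintro c u ⟨hu, hu'⟩
    refine ⟨A.domain.smul_mem c hu, ?_⟩
    have : (⟨c • u, A.domain.smul_mem c hu⟩ : A.domain) = c • ⟨u, hu⟩ := rfl
    rw [this, A.map_smul, hu', smul_comm]

/-- The point spectrum `σ_p(A)`, i.e. the set of eigenvalues. -/
def pointSpectrumOp (A : E →ₗ.[ℂ] E) : Set ℂ :=
  {z | ∃ u ∈ eigenspaceOp A z, u ≠ 0}

end Operators

/-! ### The Sobolev space `H¹(0,1)` -/

/-- Lebesgue measure on the interval `(0,1)`. -/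
abbrev mu01 : Measure ℝ := volume.restrict (Ioo (0 : ℝ) 1)

/-- The complex Hilbert space `L²(0,1)`. -/
abbrev L2 : Type := Lp ℂ 2 mu01

/-- `v` is the weak derivative of `u` on `(0,1)`. -/
def HasWeakDeriv (u v : ℝ → ℂ) : Prop :=
  ∀ φ : ℝ → ℝ, ContDiff ℝ ∞ φ → HasCompactSupport φ → tsupport φ ⊆ Ioo (0 : ℝ) 1 →
    ∫ x in Ioo (0 : ℝ) 1, deriv φ x • u x = - ∫ x in Ioo (0 : ℝ) 1, φ x • v x

theorem integrable_L2 (u : L2) : Integrable u mu01 :=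
  (Lp.memLp u).integrable one_le_two

theorem integrable_smul_of_continuous {ψ : ℝ → ℝ} (hψ : Continuous ψ) {u : ℝ → ℂ}
    (hu : Integrable u mu01) : Integrable (fun x => ψ x • u x) mu01 := by
  have h1 : IntegrableOn u (Icc (0 : ℝ) 1) volume :=
    (integrableOn_Icc_iff_integrableOn_Ioo enorm_ne_top enorm_ne_top).2 hu
  have h2 := h1.continuousOn_smul hψ.continuousOn isCompact_Icc
  exact (integrableOn_Icc_iff_integrableOn_Ioo enorm_ne_top enorm_ne_top).1 h2

theorem HasWeakDeriv.congr {u v u' v' : ℝ → ℂ} (h : HasWeakDeriv u v)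
    (hu : u' =ᵐ[mu01] u) (hv : v' =ᵐ[mu01] v) : HasWeakDeriv u' v' := by
  intro φ h1 h2 h3
  have e1 : ∫ x in Ioo (0 : ℝ) 1, deriv φ x • u' x = ∫ x in Ioo (0 : ℝ) 1, deriv φ x • u x :=
    integral_congr_ae (by filter_upwards [hu] with x hx; rw [hx])
  have e2 : ∫ x in Ioo (0 : ℝ) 1, φ x • v' x = ∫ x in Ioo (0 : ℝ) 1, φ x • v x :=
    integral_congr_ae (by filter_upwards [hv] with x hx; rw [hx])
  rw [e1, e2, h φ h1 h2 h3]

theorem HasWeakDeriv.add {u v u' v' : ℝ → ℂ} (h : HasWeakDeriv u v) (h' : HasWeakDeriv u' v')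
    (hu : Integrable u mu01) (hv : Integrable v mu01)
    (hu' : Integrable u' mu01) (hv' : Integrable v' mu01) :
    HasWeakDeriv (u + u') (v + v') := by
  intro φ h1 h2 h3
  have c1 : Continuous (deriv φ) := h1.continuous_deriv (by simp)
  have c0 : Continuous φ := h1.continuous
  simp only [Pi.add_apply, smul_add]
  rw [integral_add (integrable_smul_of_continuous c1 hu) (integrable_smul_of_continuous c1 hu'),
    integral_add (integrable_smul_of_continuous c0 hv) (integrable_smul_of_continuous c0 hv'),
    h φ h1 h2 h3, h' φ h1 h2 h3, neg_add]

theorem HasWeakDeriv.smul {u v : ℝ → ℂ} (h : HasWeakDeriv u v) (c : ℂ) :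
    HasWeakDeriv (c • u) (c • v) := by
  intro φ h1 h2 h3
  simp only [Pi.smul_apply, smul_comm _ c]
  rw [integral_smul, integral_smul, h φ h1 h2 h3, smul_neg]

/-- The Sobolev space `H¹(0,1)`, realized as the space of pairs `(u, u')` in `L² × L²` where `u'`
is the weak derivative of `u`. As a subspace of the Hilbert sum `L² ⊕ L²` it carries the norm
`‖u‖² = ∫ |u|² + ∫ |u'|²` and the standard inner product. -/
def H1Submodule : Submodule ℂ (WithLp 2 (L2 × L2)) where
  carrier := {x | HasWeakDeriv x.fst x.snd}
  zero_mem' := by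
    have h : HasWeakDeriv (0 : ℝ → ℂ) 0 := by intro φ _ _ _; simp
    exact h.congr (Lp.coeFn_zero _ _ _) (Lp.coeFn_zero _ _ _)
  add_mem' := by
    intro x y hx hy
    exact (HasWeakDeriv.add hx hy (integrable_L2 _) (integrable_L2 _) (integrable_L2 _)
      (integrable_L2 _)).congr (Lp.coeFn_add _ _) (Lp.coeFn_add _ _)
  smul_mem' := by
    intro c x hx
    exact (HasWeakDeriv.smul hx c).congr (Lp.coeFn_smul _ _) (Lp.coeFn_smul _ _)

/-- The Hilbert space `H¹(0,1)`. -/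
def H1 : Type := H1Submodule

instance : NormedAddCommGroup H1 := inferInstanceAs (NormedAddCommGroup H1Submodule)
instance : InnerProductSpace ℂ H1 := inferInstanceAs (InnerProductSpace ℂ H1Submodule)

namespace H1

/-- The `L²` function underlying an element of `H¹(0,1)`. -/
def fn (x : H1) : L2 := x.1.fst

/-- The weak derivative of an element of `H¹(0,1)`. -/
def wd (x : H1) : L2 := x.1.snd

/-- The element of `H¹(0,1)` with function `u` and weak derivative `v`. -/
def mk (u v : L2) (h : HasWeakDeriv u v) : H1 := (⟨WithLp.toLp 2 (u, v), h⟩ : H1Submodule)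

theorem hasWeakDeriv (x : H1) : HasWeakDeriv x.fn x.wd := x.2

@[simp] theorem fn_add (x y : H1) : (x + y).fn = x.fn + y.fn := rfl
@[simp] theorem wd_add (x y : H1) : (x + y).wd = x.wd + y.wd := rfl
@[simp] theorem fn_smul (c : ℂ) (x : H1) : (c • x).fn = c • x.fn := rfl
@[simp] theorem wd_smul (c : ℂ) (x : H1) : (c • x).wd = c • x.wd := rfl
@[simp] theorem fn_zero : (0 : H1).fn = 0 := rfl
@[simp] theorem wd_zero : (0 : H1).wd = 0 := rfl

theorem norm_sq (x : H1) : ‖x‖ ^ 2 = ‖x.fn‖ ^ 2 + ‖x.wd‖ ^ 2 :=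
  WithLp.prod_norm_sq_eq_of_L2 x.1

theorem norm_fn_le (x : H1) : ‖x.fn‖ ≤ ‖x‖ := by
  have := norm_sq x
  nlinarith [norm_nonneg x, norm_nonneg x.fn, sq_nonneg ‖x.wd‖]

theorem norm_wd_le (x : H1) : ‖x.wd‖ ≤ ‖x‖ := by
  have := norm_sq x
  nlinarith [norm_nonneg x, norm_nonneg x.wd, sq_nonneg ‖x.fn‖]

/-- An element of `H¹(0,1)` is determined by its underlying `L²` function. -/
theorem eq_zero_of_fn {x : H1} (h : x.fn = 0) : x = 0 := by
  have hw : x.wd = 0 := by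
    have hae : ∀ᵐ t ∂volume, t ∈ Ioo (0 : ℝ) 1 → x.wd t = 0 := by
      refine isOpen_Ioo.ae_eq_zero_of_integral_contDiff_smul_eq_zero
        (IntegrableOn.locallyIntegrableOn (integrable_L2 x.wd)) ?_
      intro φ h1 h2 h3
      have h4 := x.hasWeakDeriv φ h1 h2 h3
      have e1 : ∫ t in Ioo (0 : ℝ) 1, deriv φ t • x.fn t = 0 := by
        rw [h]
        refine integral_eq_zero_of_ae ?_
        filter_upwards [Lp.coeFn_zero ℂ 2 mu01] with t ht
        rw [ht]; simp
      rw [e1, eq_comm, neg_eq_zero] at h4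
      rw [← h4, setIntegral_eq_integral_of_forall_compl_eq_zero]
      intro t ht
      have : φ t = 0 := image_eq_zero_of_notMem_tsupport fun h => ht (h3 h)
      simp [this]
    refine Lp.ext ?_
    rw [← ae_restrict_iff' measurableSet_Ioo] at hae
    filter_upwards [hae, Lp.coeFn_zero ℂ 2 mu01] with t h1 h2
    rw [h1, h2]; rfl
  have : ‖x‖ ^ 2 = 0 := by rw [norm_sq, h, hw]; simp
  exact norm_eq_zero.1 (pow_eq_zero_iff two_ne_zero |>.1 this)

theorem ext_fn {x y : H1} (h : x.fn = y.fn) : x = y := by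
  rw [← sub_eq_zero]
  apply eq_zero_of_fn
  change x.fn - y.fn = 0
  rw [h, sub_self]

end H1

/-! ### Classical functions as elements of `H¹(0,1)` -/

theorem memLp_of_continuousOn {f : ℝ → ℂ} (hf : ContinuousOn f (Icc (0 : ℝ) 1)) :
    MemLp f 2 mu01 := by
  obtain ⟨C, hC⟩ := isCompact_Icc.exists_bound_of_continuousOn hf
  refine MemLp.of_bound ?_ C ?_
  · exact (hf.mono Ioo_subset_Icc_self).aestronglyMeasurable measurableSet_Ioo
  · filter_upwards [ae_restrict_mem measurableSet_Ioo] with x hx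
    exact hC x (Ioo_subset_Icc_self hx)

/-- A primitive of an integrable function has that function as its weak derivative. -/
theorem hasWeakDeriv_primitive {v : ℝ → ℂ} (hv : Integrable v mu01) (c : ℂ) :
    HasWeakDeriv (fun x => c + ∫ s in (0 : ℝ)..x, v s) v := by
  intro φ h1 h2 h3
  have c1 : Continuous (deriv φ) := h1.continuous_deriv (by simp)
  have z0 : φ 0 = 0 := image_eq_zero_of_notMem_tsupport fun h => lt_irrefl _ (h3 h).1
  have z1 : φ 1 = 0 := image_eq_zero_of_notMem_tsupport fun h => lt_irrefl _ (h3 h).2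
  have ftc : ∀ a b : ℝ, ∫ x in a..b, deriv φ x = φ b - φ a := fun a b =>
    intervalIntegral.integral_deriv_eq_sub
      (fun x _ => (h1.differentiable (by simp)).differentiableAt) (c1.intervalIntegrable a b)
  have hφ' : Integrable (deriv φ) mu01 :=
    ((c1.continuousOn (s := Icc (0 : ℝ) 1)).integrableOn_compact isCompact_Icc).mono_set
      Ioo_subset_Icc_self
  -- the kernel on the triangle `s < x`
  have hK : Integrable (Function.uncurry fun x s : ℝ =>
      ({q : ℝ × ℝ | q.2 < q.1}.indicator (fun q => deriv φ q.1 • v q.2)) (x, s))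
      (mu01.prod mu01) :=
    (hφ'.smul_prod hv).indicator (measurableSet_lt measurable_snd measurable_fst)
  have swap := integral_integral_swap hK
  have L : ∀ x ∈ Ioo (0 : ℝ) 1,
      ∫ s, ({q : ℝ × ℝ | q.2 < q.1}.indicator (fun q => deriv φ q.1 • v q.2)) (x, s) ∂mu01
        = deriv φ x • ∫ s in (0 : ℝ)..x, v s := by
    intro x hx
    have : (fun s => ({q : ℝ × ℝ | q.2 < q.1}.indicator (fun q => deriv φ q.1 • v q.2)) (x, s))
        = (Iio x).indicator (fun s => deriv φ x • v s) := by
      ext s; simp [indicator]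
    rw [this, integral_indicator measurableSet_Iio, Measure.restrict_restrict measurableSet_Iio,
      integral_smul, intervalIntegral.integral_of_le hx.1.le, integral_Ioc_eq_integral_Ioo]
    congr 3
    ext s; simp only [mem_inter_iff, mem_Iio, mem_Ioo]
    exact ⟨fun h => ⟨h.2.1, h.1⟩, fun h => ⟨h.2, h.1, h.2.trans hx.2⟩⟩
  have R : ∀ s ∈ Ioo (0 : ℝ) 1,
      ∫ x, ({q : ℝ × ℝ | q.2 < q.1}.indicator (fun q => deriv φ q.1 • v q.2)) (x, s) ∂mu01
        = -(φ s • v s) := by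
    intro s hs
    have : (fun x => ({q : ℝ × ℝ | q.2 < q.1}.indicator (fun q => deriv φ q.1 • v q.2)) (x, s))
        = (Ioi s).indicator (fun x => deriv φ x • v s) := by
      ext x; simp [indicator]
    have e : Ioi s ∩ Ioo (0 : ℝ) 1 = Ioo s 1 := by
      ext x; simp only [mem_inter_iff, mem_Ioi, mem_Ioo]
      exact ⟨fun h => ⟨h.1, h.2.2⟩, fun h => ⟨h.1, hs.1.trans h.1, h.2⟩⟩
    rw [this, integral_indicator measurableSet_Ioi, Measure.restrict_restrict measurableSet_Ioi, e,
      integral_smul_const, ← integral_Ioc_eq_integral_Ioo,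
      ← intervalIntegral.integral_of_le hs.2.le, ftc, z1, zero_sub, neg_smul]
  have swap' : ∫ x, deriv φ x • (∫ s in (0 : ℝ)..x, v s) ∂mu01 = -∫ s, φ s • v s ∂mu01 := by
    rw [← integral_neg]
    refine Eq.trans (integral_congr_ae ?_) (swap.trans (integral_congr_ae ?_))
    · filter_upwards [ae_restrict_mem measurableSet_Ioo] with x hx using (L x hx).symm
    · filter_upwards [ae_restrict_mem measurableSet_Ioo] with x hx using R x hx
  have hi2 : Integrable (fun x => deriv φ x • ∫ s in (0 : ℝ)..x, v s) mu01 := by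
    refine hK.integral_prod_left.congr ?_
    filter_upwards [ae_restrict_mem measurableSet_Ioo] with x hx using L x hx
  simp only [smul_add]
  rw [integral_add (hφ'.smul_const c) hi2, swap', integral_smul_const,
    ← integral_Ioc_eq_integral_Ioo, ← intervalIntegral.integral_of_le zero_le_one, ftc, z0, z1]
  simp

/-- The continuous function `ρ ↦ ∫₀^ρ u`. -/
theorem continuousOn_primitive {v : ℝ → ℂ} (hv : Integrable v mu01) :
    ContinuousOn (fun x => ∫ s in (0 : ℝ)..x, v s) (Icc (0 : ℝ) 1) := by
  have h := intervalIntegral.continuousOn_primitive_interval (μ := volume) (f := v)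
    (a := 0) (b := 1) (by
      rw [uIcc_of_le zero_le_one]; exact (integrableOn_Icc_iff_integrableOn_Ioo enorm_ne_top enorm_ne_top).2 hv)
  rwa [uIcc_of_le zero_le_one] at h

/-- The derivative of a function on `[0,1]` (one-sided at the end points). -/
abbrev D (f : ℝ → ℂ) : ℝ → ℂ := derivWithin f (Icc (0 : ℝ) 1)

theorem continuousOn_D {f : ℝ → ℂ} (hf : ContDiffOn ℝ 1 f (Icc (0 : ℝ) 1)) :
    ContinuousOn (D f) (Icc (0 : ℝ) 1) :=
  hf.continuousOn_derivWithin (uniqueDiffOn_Icc zero_lt_one) le_rfl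

theorem hasWeakDeriv_of_contDiffOn {f : ℝ → ℂ} (hf : ContDiffOn ℝ 1 f (Icc (0 : ℝ) 1)) :
    HasWeakDeriv f (D f) := by
  have hD := continuousOn_D hf
  have hint : Integrable (D f) mu01 := (memLp_of_continuousOn hD).integrable one_le_two
  refine (hasWeakDeriv_primitive hint (f 0)).congr ?_ (Filter.EventuallyEq.refl _ _)
  filter_upwards [ae_restrict_mem measurableSet_Ioo] with x hx
  have hsub : Icc 0 x ⊆ Icc (0 : ℝ) 1 := Icc_subset_Icc_right hx.2.le
  rw [intervalIntegral.integral_eq_sub_of_hasDerivAt_of_le hx.1.le (hf.continuousOn.mono hsub)]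
  · ring
  · intro y hy
    have hy' : y ∈ Ioo (0 : ℝ) 1 := ⟨hy.1, hy.2.trans hx.2⟩
    exact (((hf.differentiableOn one_ne_zero) y
      (Ioo_subset_Icc_self hy')).hasDerivWithinAt).hasDerivAt (Icc_mem_nhds hy'.1 hy'.2)
  · exact (hD.mono (by rw [uIcc_of_le hx.1.le]; exact hsub)).intervalIntegrable

/-- A function in `C¹[0,1]`, regarded as an element of `H¹(0,1)`. -/
def ofC1 (f : ℝ → ℂ) (hf : ContDiffOn ℝ 1 f (Icc (0 : ℝ) 1)) : H1 :=
  H1.mk ((memLp_of_continuousOn hf.continuousOn).toLp f)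
    ((memLp_of_continuousOn (continuousOn_D hf)).toLp (D f))
    ((hasWeakDeriv_of_contDiffOn hf).congr (MemLp.coeFn_toLp _) (MemLp.coeFn_toLp _))

theorem fn_ofC1 {f : ℝ → ℂ} (hf : ContDiffOn ℝ 1 f (Icc (0 : ℝ) 1)) :
    (ofC1 f hf).fn =ᵐ[mu01] f :=
  MemLp.coeFn_toLp (memLp_of_continuousOn hf.continuousOn)

theorem wd_ofC1 {f : ℝ → ℂ} (hf : ContDiffOn ℝ 1 f (Icc (0 : ℝ) 1)) :
    (ofC1 f hf).wd =ᵐ[mu01] D f :=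
  MemLp.coeFn_toLp (memLp_of_continuousOn (continuousOn_D hf))

/-! ### The Hilbert space `𝓗 = {u ∈ H¹(0,1) : u(0) = 0} × H¹(0,1)` -/

/-- The continuous representative of `u ∈ H¹(0,1)` satisfies `u(0) = 0`. -/
def VanishesAtZero (u : H1) : Prop :=
  ∃ f : ℝ → ℂ, ContinuousOn f (Icc (0 : ℝ) 1) ∧ u.fn =ᵐ[mu01] f ∧ f 0 = 0

/-- The space `{u ∈ H¹(0,1) : u(0) = 0} × H¹(0,1)` with the norm
`‖(u₁, u₂)‖² = ‖u₁‖² + ‖u₂‖²` (norms in `H¹`). -/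
def HSubmodule : Submodule ℂ (WithLp 2 (H1 × H1)) where
  carrier := {u | VanishesAtZero u.fst}
  zero_mem' := ⟨0, continuousOn_const, Lp.coeFn_zero _ _ _, rfl⟩
  add_mem' := by
    rintro u v ⟨f, hf, hf', hf0⟩ ⟨g, hg, hg', hg0⟩
    exact ⟨f + g, hf.add hg, (Lp.coeFn_add _ _).trans (hf'.add hg'), by simp [hf0, hg0]⟩
  smul_mem' := by
    rintro c u ⟨f, hf, hf', hf0⟩
    exact ⟨c • f, hf.const_smul c, (Lp.coeFn_smul _ _).trans (hf'.const_smul c), by simp [hf0]⟩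

/-- The Hilbert space `𝓗`. -/
def HSpace : Type := HSubmodule

instance : NormedAddCommGroup HSpace := inferInstanceAs (NormedAddCommGroup HSubmodule)
instance : InnerProductSpace ℂ HSpace := inferInstanceAs (InnerProductSpace ℂ HSubmodule)

/-- First component of an element of `𝓗`. -/
def comp1 (u : HSpace) : H1 := u.1.fst

/-- Second component of an element of `𝓗`. -/
def comp2 (u : HSpace) : H1 := u.1.snd

/-- The element `(u₁, u₂)` of `𝓗`. -/
def HSpace.mk (u₁ u₂ : H1) (h : VanishesAtZero u₁) : HSpace :=
  (⟨WithLp.toLp 2 (u₁, u₂), h⟩ : HSubmodule)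

theorem HSpace.norm_sq (u : HSpace) : ‖u‖ ^ 2 = ‖comp1 u‖ ^ 2 + ‖comp2 u‖ ^ 2 :=
  WithLp.prod_norm_sq_eq_of_L2 u.1

theorem norm_comp1_le (u : HSpace) : ‖comp1 u‖ ≤ ‖u‖ := by
  have := HSpace.norm_sq u
  nlinarith [norm_nonneg u, norm_nonneg (comp1 u), sq_nonneg ‖comp2 u‖]

theorem norm_comp2_le (u : HSpace) : ‖comp2 u‖ ≤ ‖u‖ := by
  have := HSpace.norm_sq u
  nlinarith [norm_nonneg u, norm_nonneg (comp2 u), sq_nonneg ‖comp1 u‖]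

theorem HSpace.ext_fn {u v : HSpace} (h1 : (comp1 u).fn = (comp1 v).fn)
    (h2 : (comp2 u).fn = (comp2 v).fn) : u = v := by
  apply Subtype.ext
  apply WithLp.ofLp_injective
  exact Prod.ext (H1.ext_fn h1) (H1.ext_fn h2)

/-- The element `(f₁, f₂)` of `𝓗` given by `f₁, f₂ ∈ C¹[0,1]` with `f₁(0) = 0`. -/
def mkH (f₁ f₂ : ℝ → ℂ) (h₁ : ContDiffOn ℝ 1 f₁ (Icc (0 : ℝ) 1))
    (h₂ : ContDiffOn ℝ 1 f₂ (Icc (0 : ℝ) 1)) (h0 : f₁ 0 = 0) : HSpace :=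
  HSpace.mk (ofC1 f₁ h₁) (ofC1 f₂ h₂) ⟨f₁, h₁.continuousOn, fn_ofC1 h₁, h0⟩

/-! ### The free operator -/

/-- The domain `{u ∈ C²[0,1] × C²[0,1] : u₁(0) = 0, u₂'(0) = 0}`, as a space of
functions (only the values on `[0,1]` matter below). -/
def ClassicalDomain : Submodule ℂ ((ℝ → ℂ) × (ℝ → ℂ)) where
  carrier := {f | ContDiffOn ℝ 2 f.1 (Icc (0 : ℝ) 1) ∧ ContDiffOn ℝ 2 f.2 (Icc (0 : ℝ) 1) ∧
    f.1 0 = 0 ∧ D f.2 0 = 0}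
  zero_mem' := ⟨contDiffOn_const, contDiffOn_const, rfl, by
    change derivWithin (fun _ => (0 : ℂ)) _ _ = 0
    simp⟩
  add_mem' := by
    rintro f g ⟨h1, h2, h3, h4⟩ ⟨k1, k2, k3, k4⟩
    refine ⟨h1.add k1, h2.add k2, by simp [h3, k3], ?_⟩
    have h0 : (0 : ℝ) ∈ Icc (0 : ℝ) 1 := ⟨le_rfl, zero_le_one⟩
    have := derivWithin_add (h2.differentiableOn two_ne_zero 0 h0)
      (k2.differentiableOn two_ne_zero 0 h0)
    change derivWithin (f.2 + g.2) _ _ = 0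
    rw [this]
    change D f.2 0 + D g.2 0 = 0
    rw [h4, k4, add_zero]
  smul_mem' := by
    rintro c f ⟨h1, h2, h3, h4⟩
    refine ⟨h1.const_smul c, h2.const_smul c, by simp [h3], ?_⟩
    have h0 : (0 : ℝ) ∈ Icc (0 : ℝ) 1 := ⟨le_rfl, zero_le_one⟩
    have := derivWithin_const_smul (c := c) (h2.differentiableOn two_ne_zero 0 h0)
    change derivWithin (c • f.2) _ _ = 0
    rw [this]
    change c • D f.2 0 = 0
    rw [h4, smul_zero]

/-- The expression `v' - ρ u' - 2/(p-1) u`. -/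
def freeExpr (p : ℝ) (u v : ℝ → ℂ) : ℝ → ℂ :=
  fun ρ => D v ρ - (ρ : ℂ) * D u ρ - ((2 / (p - 1) : ℝ) : ℂ) * u ρ

theorem contDiffOn_freeExpr (p : ℝ) {u v : ℝ → ℂ} (hu : ContDiffOn ℝ 2 u (Icc (0 : ℝ) 1))
    (hv : ContDiffOn ℝ 2 v (Icc (0 : ℝ) 1)) :
    ContDiffOn ℝ 1 (freeExpr p u v) (Icc (0 : ℝ) 1) := by
  have hI := uniqueDiffOn_Icc (zero_lt_one (α := ℝ))
  have du : ContDiffOn ℝ 1 (D u) (Icc (0 : ℝ) 1) := hu.derivWithin hI (by norm_num)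
  have dv : ContDiffOn ℝ 1 (D v) (Icc (0 : ℝ) 1) := hv.derivWithin hI (by norm_num)
  have hρ : ContDiffOn ℝ 1 (fun ρ : ℝ => (ρ : ℂ)) (Icc (0 : ℝ) 1) :=
    Complex.ofRealCLM.contDiff.contDiffOn
  exact (dv.sub (hρ.mul du)).sub (contDiffOn_const.mul (hu.of_le (by norm_num)))

theorem freeExpr_zero (p : ℝ) {u v : ℝ → ℂ} (hu : u 0 = 0) (hv : D v 0 = 0) :
    freeExpr p u v 0 = 0 := by
  simp [freeExpr, hu, hv]

theorem freeExpr_add (p : ℝ) {u v u' v' : ℝ → ℂ}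
    (hu : ContDiffOn ℝ 2 u (Icc (0 : ℝ) 1)) (hv : ContDiffOn ℝ 2 v (Icc (0 : ℝ) 1))
    (hu' : ContDiffOn ℝ 2 u' (Icc (0 : ℝ) 1)) (hv' : ContDiffOn ℝ 2 v' (Icc (0 : ℝ) 1))
    {x : ℝ} (hx : x ∈ Icc (0 : ℝ) 1) :
    freeExpr p (u + u') (v + v') x = freeExpr p u v x + freeExpr p u' v' x := by
  have e1 : D (u + u') x = D u x + D u' x := derivWithin_add
    (hu.differentiableOn two_ne_zero x hx) (hu'.differentiableOn two_ne_zero x hx)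
  have e2 : D (v + v') x = D v x + D v' x := derivWithin_add
    (hv.differentiableOn two_ne_zero x hx) (hv'.differentiableOn two_ne_zero x hx)
  simp only [freeExpr, e1, e2, Pi.add_apply]
  ring

theorem freeExpr_smul (p : ℝ) (c : ℂ) {u v : ℝ → ℂ}
    (hu : ContDiffOn ℝ 2 u (Icc (0 : ℝ) 1)) (hv : ContDiffOn ℝ 2 v (Icc (0 : ℝ) 1))
    {x : ℝ} (hx : x ∈ Icc (0 : ℝ) 1) :
    freeExpr p (c • u) (c • v) x = c • freeExpr p u v x := by
  have e1 : D (c • u) x = c • D u x :=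
    derivWithin_const_smul c (hu.differentiableOn two_ne_zero x hx)
  have e2 : D (c • v) x = c • D v x :=
    derivWithin_const_smul c (hv.differentiableOn two_ne_zero x hx)
  simp only [freeExpr, e1, e2, Pi.smul_apply, smul_eq_mul]
  ring

theorem ae_of_Icc {P : ℝ → Prop} (h : ∀ x ∈ Icc (0 : ℝ) 1, P x) : ∀ᵐ x ∂mu01, P x := by
  filter_upwards [ae_restrict_mem measurableSet_Ioo] with x hx
  exact h x (Ioo_subset_Icc_self hx)

theorem ofC1_add_fn {f g h : ℝ → ℂ} (hf : ContDiffOn ℝ 1 f (Icc (0 : ℝ) 1))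
    (hg : ContDiffOn ℝ 1 g (Icc (0 : ℝ) 1)) (hh : ContDiffOn ℝ 1 h (Icc (0 : ℝ) 1))
    (e : ∀ x ∈ Icc (0 : ℝ) 1, h x = f x + g x) :
    (ofC1 h hh).fn = (ofC1 f hf).fn + (ofC1 g hg).fn := by
  refine Lp.ext ?_
  filter_upwards [fn_ofC1 hf, fn_ofC1 hg, fn_ofC1 hh, ae_of_Icc e,
    Lp.coeFn_add (ofC1 f hf).fn (ofC1 g hg).fn] with x h1 h2 h3 h4 h5
  rw [h3, h4, h5, Pi.add_apply, h1, h2]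

theorem ofC1_smul_fn {f h : ℝ → ℂ} (c : ℂ) (hf : ContDiffOn ℝ 1 f (Icc (0 : ℝ) 1))
    (hh : ContDiffOn ℝ 1 h (Icc (0 : ℝ) 1)) (e : ∀ x ∈ Icc (0 : ℝ) 1, h x = c • f x) :
    (ofC1 h hh).fn = c • (ofC1 f hf).fn := by
  refine Lp.ext ?_
  filter_upwards [fn_ofC1 hf, fn_ofC1 hh, ae_of_Icc e,
    Lp.coeFn_smul c (ofC1 f hf).fn] with x h1 h3 h4 h5
  rw [h3, h4, h5, Pi.smul_apply, h1]

theorem ClassicalDomain.c1 (f : ClassicalDomain) : ContDiffOn ℝ 1 f.1.1 (Icc (0 : ℝ) 1) :=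
  f.2.1.of_le (by norm_num)

theorem ClassicalDomain.c2 (f : ClassicalDomain) : ContDiffOn ℝ 1 f.1.2 (Icc (0 : ℝ) 1) :=
  f.2.2.1.of_le (by norm_num)

theorem ClassicalDomain.e1 (p : ℝ) (f : ClassicalDomain) :
    ContDiffOn ℝ 1 (freeExpr p f.1.1 f.1.2) (Icc (0 : ℝ) 1) :=
  contDiffOn_freeExpr p f.2.1 f.2.2.1

theorem ClassicalDomain.e2 (p : ℝ) (f : ClassicalDomain) :
    ContDiffOn ℝ 1 (freeExpr p f.1.2 f.1.1) (Icc (0 : ℝ) 1) :=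
  contDiffOn_freeExpr p f.2.2.1 f.2.1

open ClassicalDomain

/-- The inclusion of the classical domain into `𝓗`. -/
def incl : ClassicalDomain →ₗ[ℂ] HSpace where
  toFun f := mkH f.1.1 f.1.2 (c1 f) (c2 f) f.2.2.2.1
  map_add' f g := HSpace.ext_fn (ofC1_add_fn (c1 f) (c1 g) (c1 (f + g)) fun _ _ => rfl)
    (ofC1_add_fn (c2 f) (c2 g) (c2 (f + g)) fun _ _ => rfl)
  map_smul' c f := HSpace.ext_fn (ofC1_smul_fn c (c1 f) (c1 (c • f)) fun _ _ => rfl)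
    (ofC1_smul_fn c (c2 f) (c2 (c • f)) fun _ _ => rfl)

/-- The classical action
`(u₁, u₂) ↦ (u₂' - ρ u₁' - 2/(p-1) u₁, u₁' - ρ u₂' - 2/(p-1) u₂)`, with values in `𝓗`. -/
def freeAction (p : ℝ) : ClassicalDomain →ₗ[ℂ] HSpace where
  toFun f := mkH (freeExpr p f.1.1 f.1.2) (freeExpr p f.1.2 f.1.1) (e1 p f) (e2 p f)
    (freeExpr_zero p f.2.2.2.1 f.2.2.2.2)
  map_add' f g := HSpace.ext_fn
    (ofC1_add_fn (e1 p f) (e1 p g) (e1 p (f + g)) fun _ hx =>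
      freeExpr_add p f.2.1 f.2.2.1 g.2.1 g.2.2.1 hx)
    (ofC1_add_fn (e2 p f) (e2 p g) (e2 p (f + g)) fun _ hx =>
      freeExpr_add p f.2.2.1 f.2.1 g.2.2.1 g.2.1 hx)
  map_smul' c f := HSpace.ext_fn
    (ofC1_smul_fn c (e1 p f) (e1 p (c • f)) fun _ hx => freeExpr_smul p c f.2.1 f.2.2.1 hx)
    (ofC1_smul_fn c (e2 p f) (e2 p (c • f)) fun _ hx => freeExpr_smul p c f.2.2.1 f.2.1 hx)

/-- The operator with domain `{u ∈ C²[0,1]² : u₁(0) = u₂'(0) = 0} ⊆ 𝓗` and classical action, given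
by its graph (see `freeOpCore_graph`). -/
def freeOpCore (p : ℝ) : HSpace →ₗ.[ℂ] HSpace :=
  (LinearMap.range (incl.prod (freeAction p))).toLinearPMap

/-- The free operator `L₀`: the closure of `freeOpCore` (which is closable, see
`freeOpCore_isClosable`). -/
def freeOp (p : ℝ) : HSpace →ₗ.[ℂ] HSpace := (freeOpCore p).closure

theorem norm_freeExpr_le (p : ℝ) {u v : ℝ → ℂ} (hu : ContDiffOn ℝ 2 u (Icc (0 : ℝ) 1))
    (hv : ContDiffOn ℝ 2 v (Icc (0 : ℝ) 1)) :
    ‖(ofC1 (freeExpr p u v) (contDiffOn_freeExpr p hu hv)).fn‖ ≤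
      ‖(ofC1 v (hv.of_le (by norm_num))).wd‖ + ‖(ofC1 u (hu.of_le (by norm_num))).wd‖ +
        |2 / (p - 1)| * ‖(ofC1 u (hu.of_le (by norm_num))).fn‖ := by
  set U := ofC1 u (hu.of_le (by norm_num))
  set V := ofC1 v (hv.of_le (by norm_num))
  set W := ofC1 (freeExpr p u v) (contDiffOn_freeExpr p hu hv)
  set c : ℂ := ((2 / (p - 1) : ℝ) : ℂ) with hc
  have key : ‖W.fn - V.wd + c • U.fn‖ ≤ ‖U.wd‖ := by
    refine Lp.norm_le_norm_of_ae_le ?_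
    filter_upwards [Lp.coeFn_add (W.fn - V.wd) (c • U.fn), Lp.coeFn_sub W.fn V.wd,
      Lp.coeFn_smul c U.fn, fn_ofC1 (contDiffOn_freeExpr p hu hv),
      wd_ofC1 (hv.of_le (m := 1) (by norm_num)), wd_ofC1 (hu.of_le (m := 1) (by norm_num)),
      fn_ofC1 (hu.of_le (m := 1) (by norm_num)),
      ae_restrict_mem measurableSet_Ioo] with x h1 h2 h3 h4 h5 h6 h7 hx
    rw [h1, Pi.add_apply, h2, h3, Pi.sub_apply, Pi.smul_apply]
    change ‖W.fn x - V.wd x + c • U.fn x‖ ≤ ‖U.wd x‖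
    rw [h4, h5, h6, h7]
    have : freeExpr p u v x - D v x + c • u x = -((x : ℂ) * D u x) := by
      simp only [freeExpr, smul_eq_mul, hc]; ring
    rw [this, norm_neg, norm_mul, Complex.norm_real, Real.norm_eq_abs, abs_of_pos hx.1]
    exact mul_le_of_le_one_left (norm_nonneg _) hx.2.le
  have hn : ‖c • U.fn‖ = |2 / (p - 1)| * ‖U.fn‖ := by
    rw [norm_smul, hc, Complex.norm_real, Real.norm_eq_abs]
  have e : W.fn = (W.fn - V.wd + c • U.fn) + V.wd - c • U.fn := by abel
  calc ‖W.fn‖ = ‖(W.fn - V.wd + c • U.fn) + V.wd - c • U.fn‖ := by rw [← e]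
    _ ≤ ‖(W.fn - V.wd + c • U.fn) + V.wd‖ + ‖c • U.fn‖ := norm_sub_le _ _
    _ ≤ ‖W.fn - V.wd + c • U.fn‖ + ‖V.wd‖ + ‖c • U.fn‖ := by gcongr; exact norm_add_le _ _
    _ ≤ _ := by rw [hn]; linarith

theorem norm_freeAction_le (p : ℝ) (f : ClassicalDomain) :
    ‖(comp1 (freeAction p f)).fn‖ ≤ (2 + |2 / (p - 1)|) * ‖incl f‖ ∧
    ‖(comp2 (freeAction p f)).fn‖ ≤ (2 + |2 / (p - 1)|) * ‖incl f‖ := by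
  have a1 : ‖(comp1 (incl f)).wd‖ ≤ ‖incl f‖ := (H1.norm_wd_le _).trans (norm_comp1_le _)
  have a2 : ‖(comp2 (incl f)).wd‖ ≤ ‖incl f‖ := (H1.norm_wd_le _).trans (norm_comp2_le _)
  have a3 : ‖(comp1 (incl f)).fn‖ ≤ ‖incl f‖ := (H1.norm_fn_le _).trans (norm_comp1_le _)
  have a4 : ‖(comp2 (incl f)).fn‖ ≤ ‖incl f‖ := (H1.norm_fn_le _).trans (norm_comp2_le _)
  have hc := abs_nonneg (2 / (p - 1))
  constructor
  · have h : ‖(comp1 (freeAction p f)).fn‖ ≤ ‖(comp2 (incl f)).wd‖ + ‖(comp1 (incl f)).wd‖ +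
        |2 / (p - 1)| * ‖(comp1 (incl f)).fn‖ := norm_freeExpr_le p f.2.1 f.2.2.1
    have := mul_le_mul_of_nonneg_left a3 hc
    linarith
  · have h : ‖(comp2 (freeAction p f)).fn‖ ≤ ‖(comp1 (incl f)).wd‖ + ‖(comp2 (incl f)).wd‖ +
        |2 / (p - 1)| * ‖(comp2 (incl f)).fn‖ := norm_freeExpr_le p f.2.2.1 f.2.1
    have := mul_le_mul_of_nonneg_left a4 hc
    linarith

/-- The bound passes to the closure of the graph, which is therefore again a graph. -/
theorem eq_zero_of_mem_closure (p : ℝ) {w : HSpace × HSpace}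
    (hw : w ∈ (LinearMap.range (incl.prod (freeAction p))).topologicalClosure)
    (h0 : w.1 = 0) : w.2 = 0 := by
  have hc1 : Continuous fun w : HSpace × HSpace => ‖(comp1 w.2).fn‖ := by
    unfold comp1 H1.fn; fun_prop
  have hc2 : Continuous fun w : HSpace × HSpace => ‖(comp2 w.2).fn‖ := by
    unfold comp2 H1.fn; fun_prop
  have hr : Continuous fun w : HSpace × HSpace => (2 + |2 / (p - 1)|) * ‖w.1‖ := by fun_prop
  have hcl : _root_.IsClosed {w : HSpace × HSpace |
      ‖(comp1 w.2).fn‖ ≤ (2 + |2 / (p - 1)|) * ‖w.1‖ ∧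
      ‖(comp2 w.2).fn‖ ≤ (2 + |2 / (p - 1)|) * ‖w.1‖} :=
    (isClosed_le hc1 hr).inter (isClosed_le hc2 hr)
  have hsub : (LinearMap.range (incl.prod (freeAction p)) : Set (HSpace × HSpace)) ⊆
      {w | ‖(comp1 w.2).fn‖ ≤ (2 + |2 / (p - 1)|) * ‖w.1‖ ∧
        ‖(comp2 w.2).fn‖ ≤ (2 + |2 / (p - 1)|) * ‖w.1‖} := by
    rintro _ ⟨f, rfl⟩
    exact norm_freeAction_le p f
  obtain ⟨h1, h2⟩ := closure_minimal hsub hcl hw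
  rw [h0, norm_zero, mul_zero] at h1 h2
  exact HSpace.ext_fn (norm_le_zero_iff.1 h1) (norm_le_zero_iff.1 h2)

theorem freeOpCore_graph (p : ℝ) :
    (freeOpCore p).graph = LinearMap.range (incl.prod (freeAction p)) :=
  Submodule.toLinearPMap_graph_eq _ fun _ hx h0 =>
    eq_zero_of_mem_closure p (Submodule.le_topologicalClosure _ hx) h0

theorem freeOpCore_isClosable (p : ℝ) : (freeOpCore p).IsClosable := by
  refine ⟨(freeOpCore p).graph.topologicalClosure.toLinearPMap, ?_⟩
  rw [Submodule.toLinearPMap_graph_eq]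
  intro w hw h0
  rw [freeOpCore_graph] at hw
  exact eq_zero_of_mem_closure p hw h0

/-! ### The perturbation and the generator -/

/-- `κ_p = 2(p+1)/(p-1)²`. -/
def kappa (p : ℝ) : ℝ := 2 * (p + 1) / (p - 1) ^ 2

/-- The primitive `ρ ↦ ∫₀^ρ u(s) ds` of `u ∈ L²(0,1)`, as an element of `H¹(0,1)`. -/
def primH1 (u : L2) : H1 :=
  H1.mk ((memLp_of_continuousOn (continuousOn_primitive (integrable_L2 u))).toLp
      (fun ρ => ∫ s in (0 : ℝ)..ρ, u s)) u <| by
    have h := hasWeakDeriv_primitive (integrable_L2 u) 0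
    simp only [zero_add] at h
    exact h.congr (MemLp.coeFn_toLp _) (Filter.EventuallyEq.refl _ _)

theorem fn_primH1 (u : L2) : (primH1 u).fn =ᵐ[mu01] fun ρ => ∫ s in (0 : ℝ)..ρ, u s :=
  MemLp.coeFn_toLp (memLp_of_continuousOn (continuousOn_primitive (integrable_L2 u)))

theorem intervalIntegrable_L2 (u : L2) {x : ℝ} (hx : x ∈ Icc (0 : ℝ) 1) :
    IntervalIntegrable u volume 0 x := by
  rw [intervalIntegrable_iff_integrableOn_Icc_of_le hx.1]
  exact ((integrableOn_Icc_iff_integrableOn_Ioo enorm_ne_top enorm_ne_top).2 (integrable_L2 u)).mono_set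
    (Icc_subset_Icc_right hx.2)

theorem primitive_congr {u v : ℝ → ℂ} (h : u =ᵐ[mu01] v) {x : ℝ} (hx : x ∈ Icc (0 : ℝ) 1) :
    ∫ s in (0 : ℝ)..x, u s = ∫ s in (0 : ℝ)..x, v s := by
  rw [intervalIntegral.integral_of_le hx.1, intervalIntegral.integral_of_le hx.1,
    integral_Ioc_eq_integral_Ioo, integral_Ioc_eq_integral_Ioo]
  exact integral_congr_ae (ae_restrict_of_ae_restrict_of_subset (Ioo_subset_Ioo_right hx.2) h)

theorem primH1_add_fn (u v : L2) : (primH1 (u + v)).fn = (primH1 u).fn + (primH1 v).fn := by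
  refine Lp.ext ?_
  filter_upwards [fn_primH1 u, fn_primH1 v, fn_primH1 (u + v),
    Lp.coeFn_add (primH1 u).fn (primH1 v).fn,
    ae_restrict_mem measurableSet_Ioo] with x h1 h2 h3 h4 hx
  have hx' := Ioo_subset_Icc_self hx
  rw [h3, h4, Pi.add_apply, h1, h2, primitive_congr (Lp.coeFn_add u v) hx']
  exact intervalIntegral.integral_add (intervalIntegrable_L2 u hx') (intervalIntegrable_L2 v hx')

theorem primH1_smul_fn (c : ℂ) (u : L2) : (primH1 (c • u)).fn = c • (primH1 u).fn := by
  refine Lp.ext ?_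
  filter_upwards [fn_primH1 u, fn_primH1 (c • u), Lp.coeFn_smul c (primH1 u).fn,
    ae_restrict_mem measurableSet_Ioo] with x h1 h3 h4 hx
  rw [h3, h4, Pi.smul_apply, h1, primitive_congr (Lp.coeFn_smul c u) (Ioo_subset_Icc_self hx)]
  exact intervalIntegral.integral_smul c _

theorem vanishesAtZero_primH1 (u : L2) : VanishesAtZero (primH1 u) :=
  ⟨_, continuousOn_primitive (integrable_L2 u), fn_primH1 u, intervalIntegral.integral_same⟩

/-- The operator `u ↦ (∫₀^ρ u₂(s) ds, 0)` on `𝓗`. -/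
def primOp : HSpace →ₗ[ℂ] HSpace where
  toFun u := HSpace.mk (primH1 (comp2 u).fn) 0 (vanishesAtZero_primH1 _)
  map_add' _ _ := HSpace.ext_fn (primH1_add_fn _ _) (add_zero _).symm
  map_smul' c _ := HSpace.ext_fn (primH1_smul_fn c _) (smul_zero c).symm

/-- The perturbation `L' u = (p κ_p ∫₀^ρ u₂(s) ds, 0)`. -/
def perturbation (p : ℝ) : HSpace →ₗ[ℂ] HSpace := ((p * kappa p : ℝ) : ℂ) • primOp

/-- The linearized generator `L = L₀ + L'` with domain `D(L) = D(L₀)`. -/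
def generator (p : ℝ) : HSpace →ₗ.[ℂ] HSpace := perturbation p +ᵥ freeOp p

/-- The symmetry mode `g(ρ) = ((p+1)/(p-1) ρ, 1)`. -/
def symmetryMode (p : ℝ) : HSpace :=
  mkH (fun ρ => (((p + 1) / (p - 1) : ℝ) : ℂ) * (ρ : ℂ)) (fun _ => 1)
    (contDiffOn_const.mul Complex.ofRealCLM.contDiff.contDiffOn) contDiffOn_const (by simp)

end BlowupStability

end

noncomputable section

namespace BlowupStability

/-! ### Primitives of square integrable functions -/

/-! Put a = 2/(p-1), so that 0 < a < 1 and p·κ_p = (a+1)(a+2). An energy estimate controls `z - L`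
up to finitely many polynomial directions, and on those directions everything is explicit.

Energy: pairing the derivatives of u with those of L₀u shows that L₀ is dissipative with constant
-(1/2 + a) in the seminorm ‖u₁'‖² + ‖u₂'‖² (`energy_estimate`), a gain of 1/2 over the claimed line
Re z = -a. When u₂(0) = 0, L' enters this pairing only through ⟨u₁', ∫₀ u₂'⟩. Taking primitives is
compact on L²(0,1), so this term is small off a finite-dimensional space, which can be chosen to
consist of polynomials (`exists_oddLT_near_primH1`).

Invariance: L maps the pairs (U, V') with U, V odd polynomials of degree less than N into
themselves. Subtract from a classical f the pair that makes the derivatives of the rest orthogonal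
to those of all such pairs: the action on the subtracted pair then disappears from the pairing. For
Re z ≥ -a the rest is therefore bounded by ‖(z - L)f‖, with N independent of z
(`exists_oddPairLT_near`).

Kernel: on polynomial pairs, (z - L)u = 0 is a recursion for the coefficients of V. Its leading
coefficient forces (z+n-2)(z+2a+n+1) = 0 with n odd, and Re z > -a leaves only n = 1, z = 1
(`natDegree_of_polyAction_eq_zero`).

If Re z > -a and z ≠ 1, then `z - L` is injective on the invariant spaces. It is thus bounded below
on the classical domain (`exists_norm_incl_le`), hence on the closed graph, and its range is closed;
the range contains the dense set of polynomial pairs, so z is in the resolvent set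
(`mem_resolventSetOp_generator`). For z = 1 an eigenfunction is a limit of classical f with (1 - L)f
→ 0. It lies in a fixed finite-dimensional polynomial space, and the recursion leaves only multiples
of g (`eigenspaceOp_generator_one`). -/

instance : IsProbabilityMeasure mu01 := ⟨by simp [mu01]⟩

theorem norm_L2_le_of_ae_bound {u : L2} {C : ℝ} (hC : 0 ≤ C) (h : ∀ᵐ x ∂mu01, ‖u x‖ ≤ C) :
    ‖u‖ ≤ C := by
  have := Lp.norm_le_of_ae_bound (p := 2) hC h
  have h1 : measureUnivNNReal mu01 = 1 := by simp [measureUnivNNReal]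
  simpa [h1] using this

/-- Cauchy–Schwarz against the indicator of (a,b). The resulting Hölder-1/2 modulus of primitives is
the source of the compactness used later. -/
theorem norm_intervalIntegral_L2_le (w : L2) {a b : ℝ} (ha : 0 ≤ a) (hab : a ≤ b) (hb : b ≤ 1) :
    ‖∫ s in a..b, w s‖ ≤ √(b - a) * ‖w‖ := by
  have hsub : Ioo a b ⊆ Ioo (0 : ℝ) 1 := Ioo_subset_Ioo ha hb
  have hr : mu01.restrict (Ioo a b) = volume.restrict (Ioo a b) := by
    rw [Measure.restrict_restrict measurableSet_Ioo, inter_eq_left.2 hsub]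
  have hm : mu01 (Ioo a b) = ENNReal.ofReal (b - a) := by
    rw [Measure.restrict_apply measurableSet_Ioo, inter_eq_left.2 hsub, Real.volume_Ioo]
  have e : ∫ s in a..b, w s =
      inner ℂ (indicatorConstLp 2 (μ := mu01) (s := Ioo a b) measurableSet_Ioo
        (by finiteness) (1 : ℂ)) w := by
    rw [L2.inner_indicatorConstLp_one, hr, intervalIntegral.integral_of_le hab,
      integral_Ioc_eq_integral_Ioo]
  rw [e]
  refine (norm_inner_le_norm _ _).trans ?_
  rw [norm_indicatorConstLp two_ne_zero (by simp), measureReal_def, hm,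
    ENNReal.toReal_ofReal (by linarith), Real.sqrt_eq_rpow]
  simp

theorem norm_primitive_le (w : L2) {x : ℝ} (hx : x ∈ Icc (0 : ℝ) 1) :
    ‖∫ s in (0 : ℝ)..x, w s‖ ≤ ‖w‖ := by
  refine (norm_intervalIntegral_L2_le w le_rfl hx.1 hx.2).trans ?_
  refine mul_le_of_le_one_left (norm_nonneg _) ?_
  rw [Real.sqrt_le_one, sub_zero]; exact hx.2

theorem norm_fn_primH1_le (w : L2) : ‖(primH1 w).fn‖ ≤ ‖w‖ := by
  refine norm_L2_le_of_ae_bound (norm_nonneg _) ?_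
  filter_upwards [fn_primH1 w, ae_restrict_mem measurableSet_Ioo] with x h hx
  rw [h]
  exact norm_primitive_le w (Ioo_subset_Icc_self hx)

@[simp] theorem wd_primH1 (w : L2) : (primH1 w).wd = w := rfl

theorem norm_primH1_le (w : L2) : ‖primH1 w‖ ≤ 2 * ‖w‖ := by
  have h1 := H1.norm_sq (primH1 w)
  have h2 := norm_fn_primH1_le w
  rw [wd_primH1] at h1
  refine abs_le_of_sq_le_sq' ?_ (by positivity) |>.2
  nlinarith [norm_nonneg w, norm_nonneg (primH1 w).fn]

/-- The primitive as a bounded operator from `L²` to `H¹`. -/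
def primCLM : L2 →L[ℂ] H1 :=
  LinearMap.mkContinuous
    { toFun := primH1
      map_add' := fun u v => H1.ext_fn (primH1_add_fn u v)
      map_smul' := fun c u => H1.ext_fn (primH1_smul_fn c u) } 2 norm_primH1_le

@[simp] theorem primCLM_apply (w : L2) : primCLM w = primH1 w := rfl

/-- Constant functions as elements of `H¹`. -/
def constH1 (c : ℂ) : H1 := ofC1 (fun _ => c) contDiffOn_const

theorem fn_constH1 (c : ℂ) : (constH1 c).fn =ᵐ[mu01] fun _ => c := fn_ofC1 _

@[simp] theorem wd_constH1 (c : ℂ) : (constH1 c).wd = 0 := by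
  refine Lp.ext ?_
  filter_upwards [wd_ofC1 (f := fun _ => c) contDiffOn_const, Lp.coeFn_zero ℂ 2 mu01] with x h h'
  rw [constH1, h, h']
  simp

theorem norm_fn_constH1 (c : ℂ) : ‖(constH1 c).fn‖ = ‖c‖ := by
  have : (constH1 c).fn = Lp.const 2 mu01 c := by
    refine Lp.ext ?_
    filter_upwards [fn_constH1 c, Lp.coeFn_const (p := 2) (μ := mu01) c] with x h h'
    rw [h, h']; rfl
  exact (congrArg norm this).trans
    ((Lp.norm_const' 2 mu01 c two_ne_zero (by simp)).trans (by simp))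

theorem norm_constH1 (c : ℂ) : ‖constH1 c‖ = ‖c‖ := by
  have h := H1.norm_sq (constH1 c)
  rw [wd_constH1, norm_fn_constH1, norm_zero] at h
  exact (sq_eq_sq₀ (norm_nonneg _) (norm_nonneg _)).1 (by linarith)

/-- The embedding of the constants into `H¹`. -/
def constCLM : ℂ →L[ℂ] H1 :=
  LinearMap.mkContinuous
    { toFun := constH1
      map_add' := fun u v => H1.ext_fn <| ofC1_add_fn contDiffOn_const contDiffOn_const
        contDiffOn_const fun _ _ => rfl
      map_smul' := fun c u => H1.ext_fn <| ofC1_smul_fn c contDiffOn_const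
        contDiffOn_const fun _ _ => rfl } 1
    fun c => by rw [one_mul]; exact (norm_constH1 c).le

@[simp] theorem constCLM_apply (c : ℂ) : constCLM c = constH1 c := rfl

/-! ### Functions with vanishing weak derivative -/

/-- A smooth function with integral zero and support in `(0,1)` is the derivative of another test
function. -/
theorem exists_testFunction_deriv {ψ : ℝ → ℝ} (h1 : ContDiff ℝ ∞ ψ) (h2 : HasCompactSupport ψ)
    (h3 : tsupport ψ ⊆ Ioo (0 : ℝ) 1) (h0 : ∫ x, ψ x = 0) :
    ∃ φ : ℝ → ℝ, ContDiff ℝ ∞ φ ∧ HasCompactSupport φ ∧ tsupport φ ⊆ Ioo (0 : ℝ) 1 ∧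
      deriv φ = ψ := by
  obtain ⟨α, β, hα, hβ, hsupp⟩ : ∃ α β : ℝ, 0 < α ∧ β < 1 ∧ tsupport ψ ⊆ Icc α β := by
    rcases (tsupport ψ).eq_empty_or_nonempty with he | hne
    · exact ⟨1 / 2, 1 / 2, by norm_num, by norm_num, by simp [he]⟩
    · obtain ⟨α, hα⟩ := IsCompact.exists_isLeast h2 hne
      obtain ⟨β, hβ⟩ := IsCompact.exists_isGreatest h2 hne
      exact ⟨α, β, (h3 hα.1).1, (h3 hβ.1).2, fun x hx => ⟨hα.2 hx, hβ.2 hx⟩⟩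
  have hc := h1.continuous
  have hz : ∀ x, x ∉ Icc α β → ψ x = 0 := fun x hx =>
    image_eq_zero_of_notMem_tsupport fun h => hx (hsupp h)
  set φ : ℝ → ℝ := fun x => ∫ s in (0 : ℝ)..x, ψ s with hφ
  have hd : ∀ x, HasDerivAt φ (ψ x) x := fun x => hc.integral_hasStrictDerivAt 0 x |>.hasDerivAt
  have hderiv : deriv φ = ψ := funext fun x => (hd x).deriv
  have hleft : ∀ x < α, φ x = 0 := by
    intro x hx
    refine intervalIntegral.integral_zero_ae (Filter.Eventually.of_forall fun s hs => hz s ?_)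
    intro h
    rcases le_total 0 x with h' | h'
    · rw [uIoc_of_le h'] at hs; linarith [hs.2, h.1]
    · rw [uIoc_of_ge h'] at hs; linarith [hs.2, h.1]
  have hright : ∀ x, β < x → φ x = 0 := by
    intro x hx
    -- `(0, max x 1]` contains `Icc α β`. The primitive at x thus differs from the full integral,
    -- which is zero, only by a piece on which ψ vanishes.
    have hall : ∫ s, ψ s = ∫ s in (0 : ℝ)..(max x 1), ψ s := by
      rw [intervalIntegral.integral_of_le (le_max_of_le_right zero_le_one)]
      symm
      refine setIntegral_eq_integral_of_forall_compl_eq_zero fun s hs => hz s fun h => hs ?_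
      exact ⟨hα.trans_le h.1, h.2.trans (hx.le.trans (le_max_left _ _))⟩
    have hsplit := intervalIntegral.integral_add_adjacent_intervals
      (hc.intervalIntegrable (μ := volume) 0 x) (hc.intervalIntegrable x (max x 1))
    have hzero : ∫ s in x..(max x 1), ψ s = 0 := by
      refine intervalIntegral.integral_zero_ae (Filter.Eventually.of_forall fun s hs => hz s ?_)
      intro h
      rw [uIoc_of_le (le_max_left _ _)] at hs; linarith [hs.1, h.2]
    rw [hzero, add_zero, ← hall, h0] at hsplit
    exact hsplit
  have hs : tsupport φ ⊆ Icc α β := by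
    refine closure_minimal (fun x hx => ?_) isClosed_Icc
    by_contra hcon
    apply hx
    by_cases hxα : x < α
    · exact hleft x hxα
    · exact hright x (not_le.1 fun h => hcon ⟨not_lt.1 hxα, h⟩)
  refine ⟨φ, ?_, HasCompactSupport.of_support_subset_isCompact isCompact_Icc
    ((subset_tsupport _).trans hs), hs.trans (Icc_subset_Ioo hα hβ), hderiv⟩
  rw [contDiff_infty_iff_deriv, hderiv]
  exact ⟨fun x => (hd x).differentiableAt, h1⟩

theorem setIntegral_testFunction {φ : ℝ → ℝ} (h3 : tsupport φ ⊆ Ioo (0 : ℝ) 1) (u : ℝ → ℂ) :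
    ∫ x in Ioo (0 : ℝ) 1, φ x • u x = ∫ x, φ x • u x := by
  refine setIntegral_eq_integral_of_forall_compl_eq_zero fun x hx => ?_
  have : φ x = 0 := image_eq_zero_of_notMem_tsupport fun h => hx (h3 h)
  simp [this]

/-- The lemma of du Bois-Reymond. -/
theorem ae_eq_const_of_hasWeakDeriv_zero {u : ℝ → ℂ} (hu : Integrable u mu01)
    (h : HasWeakDeriv u 0) : ∃ c : ℂ, ∀ᵐ x ∂mu01, u x = c := by
  obtain ⟨η, hη, hs1, hs2, hη1⟩ : ∃ η : ℝ → ℝ, ContDiff ℝ ∞ η ∧ HasCompactSupport η ∧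
      tsupport η ⊆ Ioo (0 : ℝ) 1 ∧ ∫ x, η x = 1 := by
    let b : ContDiffBump (1 / 2 : ℝ) := ⟨1 / 8, 1 / 4, by norm_num, by norm_num⟩
    refine ⟨b.normed volume, b.contDiff_normed, b.hasCompactSupport_normed, ?_, b.integral_normed⟩
    rw [b.tsupport_normed_eq, Real.closedBall_eq_Icc]
    exact Icc_subset_Ioo (by norm_num [b]) (by norm_num [b])
  have hη0 : Continuous η := hη.continuous
  -- For every test function ψ, ψ - (∫ψ)η has mean zero and is therefore the derivative of a test
  -- function, so ∫ uψ = (∫ψ)(∫ uη). This identifies the constant as ∫ uη.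
  set c : ℂ := ∫ x in Ioo (0 : ℝ) 1, η x • u x with hc
  refine ⟨c, ?_⟩
  have hint : ∀ {ψ : ℝ → ℝ}, Continuous ψ → Integrable (fun x => ψ x • u x) mu01 :=
    fun hψ => integrable_smul_of_continuous hψ hu
  have key : ∀ᵐ x ∂volume, x ∈ Ioo (0 : ℝ) 1 → u x - c = 0 := by
    refine isOpen_Ioo.ae_eq_zero_of_integral_contDiff_smul_eq_zero
      (IntegrableOn.locallyIntegrableOn (hu.sub (integrable_const c))) ?_
    intro ψ h1 h2 h3
    have hψ0 : Continuous ψ := h1.continuous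
    set m : ℝ := ∫ x, ψ x with hm
    have hts : tsupport (fun x => ψ x - m * η x) ⊆ Ioo (0 : ℝ) 1 := by
      refine (tsupport_sub ψ (fun x => m * η x)).trans (union_subset h3 ?_)
      exact (tsupport_mul_subset_right (f := fun _ => m) (g := η)).trans hs2
    have hcs : HasCompactSupport (fun x => ψ x - m * η x) := h2.sub hs1.mul_left
    have hz : ∫ x, (ψ x - m * η x) = 0 := by
      rw [integral_sub (hψ0.integrable_of_hasCompactSupport h2)
        ((hη0.integrable_of_hasCompactSupport hs1).const_mul m), integral_const_mul, hη1]
      simp [hm]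
    obtain ⟨φ, k1, k2, k3, k4⟩ := exists_testFunction_deriv
      (h1.sub (contDiff_const.mul hη)) hcs hts hz
    have h5 := h φ k1 k2 k3
    rw [k4] at h5
    simp only [Pi.zero_apply, smul_zero, integral_zero, neg_zero, sub_smul, mul_smul] at h5
    rw [integral_sub (hint hψ0) (g := fun x => m • η x • u x) ((hint hη0).smul m),
      integral_smul, ← hc, sub_eq_zero] at h5
    rw [← setIntegral_testFunction h3]
    simp only [smul_sub]
    have hψi : Integrable ψ mu01 := (hψ0.integrable_of_hasCompactSupport h2).restrict
    rw [integral_sub (hint hψ0) (hψi.smul_const c), h5, integral_smul_const,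
      setIntegral_eq_integral_of_forall_compl_eq_zero, ← hm, sub_self]
    exact fun x hx => image_eq_zero_of_notMem_tsupport fun h => hx (h3 h)
  rw [← ae_restrict_iff' measurableSet_Ioo] at key
  filter_upwards [key] with x hx using sub_eq_zero.1 hx

theorem exists_eq_constH1_add_primH1 (u : H1) : ∃ c : ℂ, u = constH1 c + primH1 u.wd := by
  have hwd : (u - primH1 u.wd).wd = 0 := by
    change u.wd - (primH1 u.wd).wd = 0
    rw [wd_primH1, sub_self]
  have hw : HasWeakDeriv (u - primH1 u.wd).fn 0 := by
    have h := (u - primH1 u.wd).hasWeakDeriv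
    rw [hwd] at h
    exact h.congr (Filter.EventuallyEq.refl _ _) (Lp.coeFn_zero _ _ _).symm
  obtain ⟨c, hc⟩ := ae_eq_const_of_hasWeakDeriv_zero (integrable_L2 _) hw
  refine ⟨c, ?_⟩
  rw [← sub_eq_iff_eq_add]
  refine H1.ext_fn (Lp.ext ?_)
  filter_upwards [hc, fn_constH1 c] with x h h'
  rw [h, h']

/-- Two continuous functions that agree almost everywhere on [0,1] agree at the end point 0 as well,
which forces the constant of integration to vanish. -/
theorem eq_primH1_of_vanishesAtZero {u : H1} (hu : VanishesAtZero u) : u = primH1 u.wd := by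
  obtain ⟨c, hc⟩ := exists_eq_constH1_add_primH1 u
  obtain ⟨f, hf, hae, hf0⟩ := hu
  have hcont : ContinuousOn (fun x => c + ∫ s in (0 : ℝ)..x, u.wd s) (Icc (0 : ℝ) 1) :=
    continuousOn_const.add (continuousOn_primitive (integrable_L2 _))
  have heq : f =ᵐ[mu01] fun x => c + ∫ s in (0 : ℝ)..x, u.wd s := by
    have h1 : u.fn = (constH1 c).fn + (primH1 u.wd).fn := by
      conv_lhs => rw [hc]
      rfl
    filter_upwards [hae, fn_constH1 c, fn_primH1 u.wd,
      Lp.coeFn_add (constH1 c).fn (primH1 u.wd).fn] with x k1 k2 k3 k4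
    rw [← k1, h1, k4, Pi.add_apply, k2, k3]
  have heq' : f =ᵐ[volume.restrict (Icc (0 : ℝ) 1)] fun x => c + ∫ s in (0 : ℝ)..x, u.wd s := by
    rwa [Measure.restrict_congr_set Ioo_ae_eq_Icc.symm]
  have := Measure.eqOn_Icc_of_ae_eq volume zero_ne_one heq' hf hcont ⟨le_rfl, zero_le_one⟩
  simp only [hf0, intervalIntegral.integral_same, add_zero] at this
  rw [← this, show constH1 0 = 0 from map_zero constCLM, zero_add] at hc
  exact hc

/-! ### Coordinates on `𝓗` -/

@[simp] theorem comp1_sub (u v : HSpace) : comp1 (u - v) = comp1 u - comp1 v := rfl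
@[simp] theorem comp2_sub (u v : HSpace) : comp2 (u - v) = comp2 u - comp2 v := rfl
@[simp] theorem comp1_smul (c : ℂ) (u : HSpace) : comp1 (c • u) = c • comp1 u := rfl
@[simp] theorem comp2_smul (c : ℂ) (u : HSpace) : comp2 (c • u) = c • comp2 u := rfl
@[simp] theorem H1.fn_sub (x y : H1) : (x - y).fn = x.fn - y.fn := rfl
@[simp] theorem H1.wd_sub (x y : H1) : (x - y).wd = x.wd - y.wd := rfl

theorem HSpace.ext_comp {u v : HSpace} (h1 : comp1 u = comp1 v) (h2 : comp2 u = comp2 v) :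
    u = v :=
  HSpace.ext_fn (by rw [h1]) (by rw [h2])

theorem comp1_eq_primH1 (u : HSpace) : comp1 u = primH1 (comp1 u).wd :=
  eq_primH1_of_vanishesAtZero (u := comp1 u) u.2

theorem norm_le_comp_add (u : HSpace) : ‖u‖ ≤ ‖comp1 u‖ + ‖comp2 u‖ := by
  refine abs_le_of_sq_le_sq' ?_ (by positivity) |>.2
  have := HSpace.norm_sq u
  nlinarith [norm_nonneg (comp1 u), norm_nonneg (comp2 u)]

/-- The parametrization `(v, c, w) ↦ (∫₀^ρ v, c + ∫₀^ρ w)` of `𝓗`. -/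
def assemble : L2 × ℂ × L2 →L[ℂ] HSpace :=
  LinearMap.mkContinuous
    { toFun := fun x => HSpace.mk (primH1 x.1) (constH1 x.2.1 + primH1 x.2.2)
        (vanishesAtZero_primH1 _)
      map_add' := fun x y => HSpace.ext_comp (primCLM.map_add _ _)
        (((constCLM.comp (ContinuousLinearMap.fst ℂ ℂ L2)) +
          (primCLM.comp (ContinuousLinearMap.snd ℂ ℂ L2))).map_add x.2 y.2)
      map_smul' := fun c x => HSpace.ext_comp (primCLM.map_smul _ _)
        (((constCLM.comp (ContinuousLinearMap.fst ℂ ℂ L2)) +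
          (primCLM.comp (ContinuousLinearMap.snd ℂ ℂ L2))).map_smul c x.2) } 5 fun x => by
    refine (norm_le_comp_add _).trans ?_
    change ‖primH1 x.1‖ + ‖constH1 x.2.1 + primH1 x.2.2‖ ≤ 5 * ‖x‖
    have h1 := norm_primH1_le x.1
    have h2 := norm_primH1_le x.2.2
    have h3 := norm_constH1 x.2.1
    have h4 := norm_add_le (constH1 x.2.1) (primH1 x.2.2)
    have k1 : ‖x.1‖ ≤ ‖x‖ := norm_fst_le x
    have k2 : ‖x.2‖ ≤ ‖x‖ := norm_snd_le x
    have k3 : ‖x.2.1‖ ≤ ‖x.2‖ := norm_fst_le x.2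
    have k4 : ‖x.2.2‖ ≤ ‖x.2‖ := norm_snd_le x.2
    linarith

@[simp] theorem comp1_assemble (x : L2 × ℂ × L2) : comp1 (assemble x) = primH1 x.1 := rfl
@[simp] theorem comp2_assemble (x : L2 × ℂ × L2) :
    comp2 (assemble x) = constH1 x.2.1 + primH1 x.2.2 := rfl

theorem assemble_surjective : Function.Surjective assemble := by
  intro u
  obtain ⟨c, hc⟩ := exists_eq_constH1_add_primH1 (comp2 u)
  refine ⟨((comp1 u).wd, c, (comp2 u).wd), HSpace.ext_comp ?_ ?_⟩
  · rw [comp1_assemble]; exact (comp1_eq_primH1 u).symm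
  · rw [comp2_assemble]; exact hc.symm

/-- Weak derivatives recover v and w. The constant is u₂ minus the primitive of w in L², and each of
these is bounded by ‖u‖: hence the factor 2. -/
theorem norm_le_norm_assemble (x : L2 × ℂ × L2) : ‖x‖ ≤ 2 * ‖assemble x‖ := by
  have e1 : (comp1 (assemble x)).wd = x.1 := by rw [comp1_assemble, wd_primH1]
  have h1 : ‖x.1‖ ≤ ‖assemble x‖ := by
    have := (H1.norm_wd_le (comp1 (assemble x))).trans (norm_comp1_le (assemble x))
    rwa [e1] at this
  have e2 : (comp2 (assemble x)).wd = x.2.2 := by simp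
  have h2 : ‖x.2.2‖ ≤ ‖comp2 (assemble x)‖ := by
    have := H1.norm_wd_le (comp2 (assemble x))
    rwa [e2] at this
  have h3 : ‖comp2 (assemble x)‖ ≤ ‖assemble x‖ := norm_comp2_le _
  have h4 : ‖x.2.1‖ ≤ 2 * ‖assemble x‖ := by
    have e : (constH1 x.2.1).fn = (comp2 (assemble x)).fn - (primH1 x.2.2).fn := by simp
    rw [← norm_fn_constH1, e]
    have := H1.norm_fn_le (comp2 (assemble x))
    have := norm_fn_primH1_le x.2.2
    have := norm_sub_le (comp2 (assemble x)).fn (primH1 x.2.2).fn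
    linarith
  have h0 := norm_nonneg (assemble x)
  rw [Prod.norm_def, Prod.norm_def]
  exact max_le (by linarith) (max_le h4 (by linarith))

/-- Completeness is transported from L² × ℂ × L² along `assemble`. It is needed to turn a lower
bound for `z - L` into closed range. -/
instance : CompleteSpace HSpace := by
  have hanti : AntilipschitzWith 2 assemble :=
    AddMonoidHomClass.antilipschitz_of_bound assemble norm_le_norm_assemble
  have h := (hanti.isUniformInducing assemble.uniformContinuous).isComplete_range
  rw [assemble_surjective.range_eq] at h
  exact completeSpace_of_isComplete_univ h

/-- An element of `𝓗` whose second component has vanishing constant part is controlled by its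
derivatives. -/
theorem norm_le_of_eq_primH1 {u : HSpace} (h : comp2 u = primH1 (comp2 u).wd) :
    ‖u‖ ≤ 2 * (‖(comp1 u).wd‖ + ‖(comp2 u).wd‖) := by
  have h1 : ‖comp1 u‖ ≤ 2 * ‖(comp1 u).wd‖ := by
    conv_lhs => rw [comp1_eq_primH1 u]
    exact norm_primH1_le _
  have h2 : ‖comp2 u‖ ≤ 2 * ‖(comp2 u).wd‖ := by
    conv_lhs => rw [h]
    exact norm_primH1_le _
  linarith [norm_le_comp_add u]

/-! ### The perturbation is bounded -/

theorem norm_primOp_le (u : HSpace) : ‖primOp u‖ ≤ 2 * ‖u‖ := by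
  refine (norm_le_comp_add _).trans ?_
  have h : ‖comp1 (primOp u)‖ ≤ 2 * ‖(comp2 u).fn‖ := norm_primH1_le _
  have h' : ‖comp2 (primOp u)‖ = 0 := norm_zero
  have := (H1.norm_fn_le (comp2 u)).trans (norm_comp2_le u)
  linarith

theorem continuous_perturbation (p : ℝ) : Continuous (perturbation p) := by
  have : Continuous primOp :=
    AddMonoidHomClass.continuous_of_bound primOp 2 norm_primOp_le
  exact this.const_smul _

/-- The perturbation as a bounded operator. -/
def perturbationCLM (p : ℝ) : HSpace →L[ℂ] HSpace := ⟨perturbation p, continuous_perturbation p⟩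

open Polynomial

/-! ### Polynomials in `L²(0,1)` -/

/-- The function on the real line given by a complex polynomial. -/
def polyFn (P : ℂ[X]) : ℝ → ℂ := fun x => P.eval (x : ℂ)

theorem hasDerivAt_polyFn (P : ℂ[X]) (x : ℝ) :
    HasDerivAt (polyFn P) (polyFn (derivative P) x) x :=
  (P.hasDerivAt (x : ℂ)).comp_ofReal

theorem contDiff_polyFn (P : ℂ[X]) {n : WithTop ℕ∞} : ContDiff ℝ n (polyFn P) := by
  have h : ContDiff ℂ n fun z : ℂ => P.eval z := by
    simpa only [coe_aeval_eq_eval] using P.contDiff_aeval (𝕜 := ℂ) n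
  exact (h.restrict_scalars ℝ).comp (Complex.ofRealCLM.contDiff (n := n))

theorem D_polyFn (P : ℂ[X]) {x : ℝ} (hx : x ∈ Icc (0 : ℝ) 1) :
    D (polyFn P) x = polyFn (derivative P) x :=
  (hasDerivAt_polyFn P x).hasDerivWithinAt.derivWithin (uniqueDiffOn_Icc zero_lt_one x hx)

theorem memLp_polyFn (P : ℂ[X]) : MemLp (polyFn P) 2 mu01 :=
  memLp_of_continuousOn (contDiff_polyFn P (n := 0)).continuous.continuousOn

/-- Polynomials as elements of `L²(0,1)`. -/
def polyL2 : ℂ[X] →ₗ[ℂ] L2 where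
  toFun P := (memLp_polyFn P).toLp
  map_add' P Q := by
    rw [← MemLp.toLp_add]
    congr 1
    ext x; simp [polyFn]
  map_smul' c P := by
    rw [RingHom.id_apply, ← MemLp.toLp_const_smul]
    congr 1
    ext x; simp [polyFn]

theorem coeFn_polyL2 (P : ℂ[X]) : polyL2 P =ᵐ[mu01] polyFn P :=
  (memLp_polyFn P).coeFn_toLp

/-- Weierstrass approximation in the variable t = x², applied to the real and imaginary parts of
g(√t). -/
theorem exists_even_polynomial_near {g : ℝ → ℂ} (hg : Continuous g) {ε : ℝ} (hε : 0 < ε) :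
    ∃ Q : ℂ[X], ∀ x ∈ Icc (0 : ℝ) 1, ‖g x - polyFn (expand ℂ 2 Q) x‖ ≤ ε := by
  obtain ⟨P, hP⟩ := exists_polynomial_near_of_continuousOn 0 1 (fun t => (g (√t)).re)
    (by fun_prop) (ε / 2) (half_pos hε)
  obtain ⟨R, hR⟩ := exists_polynomial_near_of_continuousOn 0 1 (fun t => (g (√t)).im)
    (by fun_prop) (ε / 2) (half_pos hε)
  refine ⟨P.map Complex.ofRealHom + C Complex.I * R.map Complex.ofRealHom, fun x hx => ?_⟩
  have hx2 : x ^ 2 ∈ Icc (0 : ℝ) 1 := ⟨sq_nonneg x, pow_le_one₀ hx.1 hx.2⟩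
  have h1 := hP _ hx2
  have h2 := hR _ hx2
  rw [Real.sqrt_sq hx.1] at h1 h2
  have hev : ∀ S : ℝ[X], (S.map Complex.ofRealHom).eval ((x : ℂ) ^ 2) = ((S.eval (x ^ 2) : ℝ) : ℂ) := by
    intro S
    have : ((x : ℂ) ^ 2) = Complex.ofRealHom (x ^ 2) := by simp
    rw [this, eval_map_apply]; rfl
  have e : g x - polyFn (expand ℂ 2 (P.map Complex.ofRealHom + C Complex.I * R.map Complex.ofRealHom)) x
      = -(((P.eval (x ^ 2) - (g x).re : ℝ) : ℂ) + ((R.eval (x ^ 2) - (g x).im : ℝ) : ℂ) * Complex.I) := by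
    rw [polyFn, expand_eval, eval_add, eval_mul, eval_C, hev, hev]
    conv_lhs => rw [← Complex.re_add_im (g x)]
    push_cast
    ring
  rw [e, norm_neg]
  refine (norm_add_le _ _).trans ?_
  rw [norm_mul, Complex.norm_I, Complex.norm_real, Complex.norm_real, Real.norm_eq_abs,
    Real.norm_eq_abs]
  linarith

theorem exists_even_polyL2_near (f : L2) {ε : ℝ} (hε : 0 < ε) :
    ∃ Q : ℂ[X], ‖f - polyL2 (expand ℂ 2 Q)‖ ≤ ε := by
  obtain ⟨g, -, hg, hgc, hgm⟩ := (Lp.memLp f).exists_hasCompactSupport_eLpNorm_sub_le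
    (by simp) (ε := ENNReal.ofReal (ε / 2)) (by simpa using hε)
  obtain ⟨Q, hQ⟩ := exists_even_polynomial_near hgc (half_pos hε)
  refine ⟨Q, ?_⟩
  have h1 : ‖f - hgm.toLp‖ ≤ ε / 2 := by
    rw [Lp.norm_def]
    refine ENNReal.toReal_le_of_le_ofReal (half_pos hε).le (le_trans (le_of_eq ?_) hg)
    refine eLpNorm_congr_ae ?_
    filter_upwards [Lp.coeFn_sub f hgm.toLp, hgm.coeFn_toLp] with x h h'
    rw [h, Pi.sub_apply, Pi.sub_apply, h']
  have h2 : ‖hgm.toLp - polyL2 (expand ℂ 2 Q)‖ ≤ ε / 2 := by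
    refine norm_L2_le_of_ae_bound (half_pos hε).le ?_
    filter_upwards [Lp.coeFn_sub hgm.toLp (polyL2 (expand ℂ 2 Q)), hgm.coeFn_toLp,
      coeFn_polyL2 (expand ℂ 2 Q), ae_restrict_mem measurableSet_Ioo] with x k1 k2 k3 hx
    rw [k1, Pi.sub_apply, k2, k3]
    exact hQ x (Ioo_subset_Icc_self hx)
  calc ‖f - polyL2 (expand ℂ 2 Q)‖
      = ‖(f - hgm.toLp) + (hgm.toLp - polyL2 (expand ℂ 2 Q))‖ := by rw [sub_add_sub_cancel]
    _ ≤ _ := norm_add_le _ _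
    _ ≤ ε := by linarith

/-- Odd polynomials. -/
def oddPoly : Submodule ℂ ℂ[X] where
  carrier := {P | ∀ n, Even n → P.coeff n = 0}
  zero_mem' := fun n _ => coeff_zero n
  add_mem' := fun hP hQ n hn => by rw [coeff_add, hP n hn, hQ n hn, add_zero]
  smul_mem' := fun c P hP n hn => by rw [coeff_smul, hP n hn, smul_zero]

theorem monomial_mem_oddPoly {n : ℕ} (hn : Odd n) (c : ℂ) : monomial n c ∈ oddPoly := by
  intro k hk
  rw [coeff_monomial, if_neg]
  rintro rfl
  exact Nat.not_even_iff_odd.2 hn hk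

theorem exists_oddPoly_derivative_eq_expand (Q : ℂ[X]) :
    ∃ U ∈ oddPoly, derivative U = expand ℂ 2 Q := by
  induction Q using Polynomial.induction_on' with
  | add P Q hP hQ =>
    obtain ⟨U, hU, hU'⟩ := hP
    obtain ⟨V, hV, hV'⟩ := hQ
    exact ⟨U + V, oddPoly.add_mem hU hV, by simp [hU', hV']⟩
  | monomial n c =>
    refine ⟨monomial (2 * n + 1) (c / (2 * n + 1)), monomial_mem_oddPoly ⟨n, rfl⟩ _, ?_⟩
    have : (2 * (n : ℂ) + 1) ≠ 0 := by norm_cast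
    rw [derivative_monomial, expand_monomial, Nat.add_sub_cancel, mul_comm n 2]
    congr 1
    push_cast
    field_simp

theorem exists_oddPoly_derivative_derivative_eq (Q : ℂ[X]) :
    ∃ V ∈ oddPoly, derivative (derivative V) = X * expand ℂ 2 Q := by
  induction Q using Polynomial.induction_on' with
  | add P Q hP hQ =>
    obtain ⟨U, hU, hU'⟩ := hP
    obtain ⟨V, hV, hV'⟩ := hQ
    exact ⟨U + V, oddPoly.add_mem hU hV, by simp [hU', hV', mul_add]⟩
  | monomial n c =>
    refine ⟨monomial (2 * n + 3) (c / ((2 * n + 3) * (2 * n + 2))),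
      monomial_mem_oddPoly ⟨n + 1, by ring⟩ _, ?_⟩
    have h3 : (2 * (n : ℂ) + 3) ≠ 0 := by norm_cast
    have h2 : (2 * (n : ℂ) + 2) ≠ 0 := by norm_cast
    rw [derivative_monomial, derivative_monomial, expand_monomial, X_mul_monomial]
    have e : 2 * n + 3 - 1 - 1 = n * 2 + 1 := by omega
    have e' : 2 * n + 3 - 1 = 2 * n + 2 := by omega
    rw [e, e']
    congr 1
    push_cast
    field_simp

theorem exists_oddPoly_derivative_near (f : L2) {ε : ℝ} (hε : 0 < ε) :
    ∃ U ∈ oddPoly, ‖f - polyL2 (derivative U)‖ ≤ ε := by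
  obtain ⟨Q, hQ⟩ := exists_even_polyL2_near f hε
  obtain ⟨U, hU, hU'⟩ := exists_oddPoly_derivative_eq_expand Q
  exact ⟨U, hU, by rwa [hU']⟩

theorem memLp_ofReal_mul (h : L2) : MemLp (fun x : ℝ => (x : ℂ) * h x) 2 mu01 := by
  refine (Lp.memLp h).of_le ?_ ?_
  · exact (Complex.continuous_ofReal.aestronglyMeasurable).mul (Lp.aestronglyMeasurable h)
  · filter_upwards [ae_restrict_mem measurableSet_Ioo] with x hx
    rw [norm_mul, Complex.norm_real, Real.norm_eq_abs, abs_of_pos hx.1]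
    exact mul_le_of_le_one_left (norm_nonneg _) hx.2.le

/-- An element of `L²(0,1)` which is orthogonal to all odd polynomials vanishes. -/
theorem eq_zero_of_inner_X_mul_expand {h : L2}
    (hh : ∀ Q : ℂ[X], inner ℂ (polyL2 (X * expand ℂ 2 Q)) h = 0) : h = 0 := by
  -- Multiplying h by x turns orthogonality to the odd functions xQ(x²) into orthogonality of xh to
  -- all even polynomials, which are dense.
  set m : L2 := (memLp_ofReal_mul h).toLp with hm
  have hmc : m =ᵐ[mu01] fun x => (x : ℂ) * h x := MemLp.coeFn_toLp _
  have horth : ∀ Q : ℂ[X], inner ℂ (polyL2 (expand ℂ 2 Q)) m = 0 := by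
    intro Q
    rw [← hh Q, L2.inner_def, L2.inner_def]
    refine integral_congr_ae ?_
    filter_upwards [hmc, coeFn_polyL2 (expand ℂ 2 Q), coeFn_polyL2 (X * expand ℂ 2 Q)]
      with x h1 h2 h3
    rw [h1, h2, h3]
    simp only [polyFn, eval_mul, eval_X, RCLike.inner_apply, map_mul, Complex.conj_ofReal]
    ring
  have hm0 : m = 0 := by
    have hd : Dense (range fun Q : ℂ[X] => polyL2 (expand ℂ 2 Q)) := by
      intro f
      rw [Metric.mem_closure_iff]
      intro ε hε
      obtain ⟨Q, hQ⟩ := exists_even_polyL2_near f (half_pos hε)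
      exact ⟨_, ⟨Q, rfl⟩, by rw [dist_eq_norm]; linarith⟩
    refine hd.eq_zero_of_inner_left ℂ ?_
    rintro _ ⟨Q, rfl⟩
    rw [← inner_conj_symm, horth, map_zero]
  refine Lp.ext ?_
  have hm0' : m =ᵐ[mu01] 0 := by rw [hm0]; exact Lp.coeFn_zero _ _ _
  filter_upwards [hmc, hm0', Lp.coeFn_zero ℂ 2 mu01, ae_restrict_mem measurableSet_Ioo]
    with x h1 h2 h3 hx
  rw [h3, Pi.zero_apply]
  rw [h2, Pi.zero_apply, eq_comm, mul_eq_zero] at h1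
  exact h1.resolve_left (by exact_mod_cast hx.1.ne')

/-- The second derivatives of odd polynomials include all xQ(x²). These vanish at 0, so uniform
approximation is not available and density comes from a trivial orthogonal complement instead. -/
theorem exists_oddPoly_derivative_derivative_near (f : L2) {ε : ℝ} (hε : 0 < ε) :
    ∃ V ∈ oddPoly, ‖f - polyL2 (derivative (derivative V))‖ ≤ ε := by
  set K : Submodule ℂ L2 := oddPoly.map (polyL2 ∘ₗ derivative ∘ₗ derivative) with hK
  have htop : K.topologicalClosure = ⊤ := by
    rw [Submodule.topologicalClosure_eq_top_iff, Submodule.eq_bot_iff]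
    intro h hh
    refine eq_zero_of_inner_X_mul_expand fun Q => ?_
    obtain ⟨V, hV, hV'⟩ := exists_oddPoly_derivative_derivative_eq Q
    refine (Submodule.mem_orthogonal _ _).1 hh _ ⟨V, hV, ?_⟩
    simp [hV']
  have hf : f ∈ closure (K : Set L2) := by
    rw [← Submodule.topologicalClosure_coe, htop]; trivial
  obtain ⟨_, ⟨V, hV, rfl⟩, h⟩ := Metric.mem_closure_iff.1 hf ε hε
  exact ⟨V, hV, by rw [dist_eq_norm] at h; exact h.le⟩

/-! ### Finite-dimensional approximation of the primitive -/

/-- Odd polynomials of degree less than `N`. -/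
def oddLT (N : ℕ) : Submodule ℂ ℂ[X] := oddPoly ⊓ degreeLT ℂ N

instance (N : ℕ) : FiniteDimensional ℂ (oddLT N) :=
  have : Module.Finite ℂ (degreeLT ℂ N) := Module.Finite.equiv (degreeLTEquiv ℂ N).symm
  Submodule.finiteDimensional_of_le inf_le_right

theorem oddLT_mono {M N : ℕ} (h : M ≤ N) : oddLT M ≤ oddLT N :=
  inf_le_inf_left _ (degreeLT_mono h)

theorem exists_mem_oddLT {U : ℂ[X]} (hU : U ∈ oddPoly) : ∃ N, U ∈ oddLT N :=
  ⟨U.natDegree + 1, hU, mem_degreeLT.2 (degree_le_natDegree.trans_lt (by norm_cast; omega))⟩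

/-- The indicator function of the `j`-th subinterval of length `1/n`. -/
def stepL2 (n j : ℕ) : L2 :=
  indicatorConstLp 2 (μ := mu01) (s := Ioc ((j : ℝ) / n) ((j + 1 : ℝ) / n)) measurableSet_Ioc
    (by finiteness) (1 : ℂ)

/-- On a subinterval of length 1/n a primitive varies by at most √(1/n)‖w‖. -/
theorem norm_primH1_sub_step_le (w : L2) {n : ℕ} (hn : 0 < n) :
    ‖(primH1 w).fn - ∑ j ∈ Finset.range n, (∫ s in (0 : ℝ)..(j / n), w s) • stepL2 n j‖ ≤
      √(1 / n) * ‖w‖ := by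
  have hn' : (0 : ℝ) < n := by exact_mod_cast hn
  set W : ℕ → ℂ := fun j => ∫ s in (0 : ℝ)..((j : ℝ) / n), w s with hW
  have hsum : ∀ k : ℕ, (∑ j ∈ Finset.range k, W j • stepL2 n j : L2) =ᵐ[mu01]
      fun x => ∑ j ∈ Finset.range k,
        W j * (Ioc ((j : ℝ) / n) ((j + 1 : ℝ) / n)).indicator (fun _ => (1 : ℂ)) x := by
    intro k
    induction k with
    | zero => 
      simp only [Finset.range_zero, Finset.sum_empty]
      exact Lp.coeFn_zero ℂ 2 mu01
    | succ k ih =>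
      rw [Finset.sum_range_succ]
      filter_upwards [Lp.coeFn_add (∑ j ∈ Finset.range k, W j • stepL2 n j) (W k • stepL2 n k),
        ih, Lp.coeFn_smul (W k) (stepL2 n k),
        indicatorConstLp_coeFn (p := 2) (μ := mu01) (hs := measurableSet_Ioc (a := (k : ℝ) / n)
          (b := (k + 1 : ℝ) / n)) (hμs := by finiteness) (c := (1 : ℂ))] with x h1 h2 h3 h4
      rw [h1, Pi.add_apply, h2, h3, Pi.smul_apply, Finset.sum_range_succ, smul_eq_mul]
      rw [stepL2, h4]
  refine norm_L2_le_of_ae_bound (by positivity) ?_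
  filter_upwards [Lp.coeFn_sub (primH1 w).fn (∑ j ∈ Finset.range n, W j • stepL2 n j),
    hsum n, fn_primH1 w, ae_restrict_mem measurableSet_Ioo] with x h1 h2 h3 hx
  rw [h1, Pi.sub_apply, h2, h3]
  -- The cells are open on the left and closed on the right, so the cell containing x has index ⌈nx⌉
  -- - 1.
  obtain ⟨j, hj⟩ : ∃ j : ℕ, ⌈(n : ℝ) * x⌉₊ = j + 1 :=
    Nat.exists_eq_succ_of_ne_zero (Nat.ceil_pos.2 (mul_pos hn' hx.1)).ne'
  have hlt : (j : ℝ) / n < x := by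
    rw [div_lt_iff₀ hn', mul_comm]
    exact Nat.lt_ceil.1 (by omega)
  have hle : x ≤ (j + 1 : ℝ) / n := by
    rw [le_div_iff₀ hn', mul_comm]
    have := Nat.le_ceil ((n : ℝ) * x)
    rw [hj] at this
    exact_mod_cast this
  have hjn : j < n := by
    have : (j : ℝ) < n := by
      rw [div_lt_iff₀ hn'] at hlt
      nlinarith [hx.2]
    exact_mod_cast this
  rw [Finset.sum_eq_single_of_mem j (Finset.mem_range.2 hjn), 
    indicator_of_mem (show x ∈ Ioc ((j : ℝ) / n) ((j + 1 : ℝ) / n) from ⟨hlt, hle⟩), mul_one]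
  · have hj0 : (0 : ℝ) ≤ j / n := by positivity
    rw [intervalIntegral.integral_interval_sub_left
      (intervalIntegrable_L2 w (Ioo_subset_Icc_self hx))
      (intervalIntegrable_L2 w ⟨hj0, hlt.le.trans hx.2.le⟩)]
    refine (norm_intervalIntegral_L2_le w hj0 hlt.le hx.2.le).trans ?_
    gcongr
    rw [add_div] at hle
    linarith
  · intro i _ hij
    rw [indicator_of_notMem, mul_zero]
    rintro ⟨hi1, hi2⟩
    rw [div_lt_iff₀ hn'] at hi1 hlt
    rw [le_div_iff₀ hn'] at hi2 hle
    have a1 : (i : ℝ) < j + 1 := hi1.trans_le hle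
    have a2 : (j : ℝ) < i + 1 := hlt.trans_le hi2
    norm_cast at a1 a2
    omega

/-- Quantitative compactness of the primitive. Step functions cost ε/2; each of the n steps is
replaced by some U_j' at cost ε/(2n), and all coefficients are at most ‖w‖. Since the U_j do not
depend on w, neither does N. -/
theorem exists_oddLT_near_primH1 {ε : ℝ} (hε : 0 < ε) :
    ∃ N, ∀ w : L2, ∃ U ∈ oddLT N, ‖(primH1 w).fn - polyL2 (derivative U)‖ ≤ ε * ‖w‖ := by
  obtain ⟨n, hn0, hn⟩ : ∃ n : ℕ, 0 < n ∧ √(1 / (n : ℝ)) ≤ ε / 2 := by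
    obtain ⟨n, hn⟩ := exists_nat_gt (1 / (ε / 2) ^ 2)
    have hn' : (0 : ℝ) < n := lt_trans (by positivity) hn
    refine ⟨n, by exact_mod_cast hn', ?_⟩
    rw [Real.sqrt_le_left (by positivity), div_le_iff₀ hn']
    rw [div_lt_iff₀ (by positivity)] at hn
    linarith
  have hn' : (0 : ℝ) < n := by exact_mod_cast hn0
  choose U hU hU' using fun j : ℕ =>
    exists_oddPoly_derivative_near (stepL2 n j) (ε := ε / 2 / n) (by positivity)
  choose M hM using fun j => exists_mem_oddLT (hU j)
  refine ⟨(Finset.range n).sup M, fun w =>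
    ⟨∑ j ∈ Finset.range n, (∫ s in (0 : ℝ)..(j / n), w s) • U j, ?_, ?_⟩⟩
  · exact Submodule.sum_mem _ fun j hj => Submodule.smul_mem _ _
      (oddLT_mono (Finset.le_sup hj) (hM j))
  · have h1 := norm_primH1_sub_step_le w hn0
    have h2 : ‖∑ j ∈ Finset.range n, (∫ s in (0 : ℝ)..(j / n), w s) • stepL2 n j -
        polyL2 (derivative (∑ j ∈ Finset.range n, (∫ s in (0 : ℝ)..(j / n), w s) • U j))‖ ≤
        ε / 2 * ‖w‖ := by
      simp only [map_sum, map_smul, ← Finset.sum_sub_distrib, ← smul_sub]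
      calc _ ≤ ∑ j ∈ Finset.range n, ‖w‖ * (ε / 2 / n) := by
            refine norm_sum_le_of_le _ fun j hj => ?_
            rw [norm_smul]
            have hj' : (j : ℝ) ≤ n := by exact_mod_cast (Finset.mem_range.1 hj).le
            exact mul_le_mul (norm_primitive_le w ⟨by positivity, (div_le_one hn').2 hj'⟩)
              (hU' j) (norm_nonneg _) (norm_nonneg _)
        _ = ε / 2 * ‖w‖ := by
            rw [Finset.sum_const, Finset.card_range, nsmul_eq_mul]
            field_simp
    have h3 := norm_sub_le_norm_sub_add_norm_sub (primH1 w).fn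
      (∑ j ∈ Finset.range n, (∫ s in (0 : ℝ)..(j / n), w s) • stepL2 n j)
      (polyL2 (derivative (∑ j ∈ Finset.range n, (∫ s in (0 : ℝ)..(j / n), w s) • U j)))
    have h4 := mul_le_mul_of_nonneg_right hn (norm_nonneg w)
    linarith

open ClassicalDomain

/-! ### The energy estimate on the classical domain -/

theorem contDiffOn_D {f : ℝ → ℂ} (hf : ContDiffOn ℝ 2 f (Icc (0 : ℝ) 1)) :
    ContDiffOn ℝ 1 (D f) (Icc (0 : ℝ) 1) :=
  hf.derivWithin (uniqueDiffOn_Icc zero_lt_one) (by norm_num)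

theorem hasDerivAt_D {f : ℝ → ℂ} (hf : ContDiffOn ℝ 1 f (Icc (0 : ℝ) 1)) {x : ℝ}
    (hx : x ∈ Ioo (0 : ℝ) 1) : HasDerivAt f (D f x) x :=
  (hf.differentiableOn one_ne_zero x (Ioo_subset_Icc_self hx)).hasDerivWithinAt.hasDerivAt
    (Icc_mem_nhds hx.1 hx.2)

theorem D_freeExpr (p : ℝ) {u v : ℝ → ℂ} (hu : ContDiffOn ℝ 2 u (Icc (0 : ℝ) 1))
    (hv : ContDiffOn ℝ 2 v (Icc (0 : ℝ) 1)) {x : ℝ} (hx : x ∈ Ioo (0 : ℝ) 1) :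
    D (freeExpr p u v) x = D (D v) x - (D u x + x * D (D u) x) -
      ((2 / (p - 1) : ℝ) : ℂ) * D u x := by
  have h1 := hasDerivAt_D (contDiffOn_D hv) hx
  have h2 := hasDerivAt_D (contDiffOn_D hu) hx
  have h3 := hasDerivAt_D (hu.of_le (m := 1) (by norm_num)) hx
  have h4 : HasDerivAt (fun y : ℝ => (y : ℂ)) 1 x := (hasDerivAt_id _).ofReal_comp
  have h := ((h1.sub (h4.mul h2)).sub (h3.const_mul ((2 / (p - 1) : ℝ) : ℂ)))
  rw [one_mul] at h
  exact h.hasDerivWithinAt.derivWithin (uniqueDiffOn_Icc zero_lt_one x (Ioo_subset_Icc_self hx))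

/-- Here v = u₁' and w = u₂'. The real part of v̄(-v - xv') equals -(x|v|²/2)' - |v|²/2, and
likewise for w: this is the gain of 1/2, and what remains is a total derivative. -/
theorem energy_pointwise (v w v' w' : ℂ) (x a : ℝ) :
    (inner ℂ v (w' - (v + x * v') - a * v) + inner ℂ w (v' - (w + x * w') - a * w)).re +
      (1 / 2 + a) * (inner ℂ v v + inner ℂ w w).re =
    ((star v' * w + star v * w') - ((1 / 2 : ℝ) * (star v * v + star w * w) +
      (x / 2 : ℝ) * ((star v' * v + star v * v') + (star w' * w + star w * w')))).re := by
  simp only [RCLike.inner_apply, Complex.add_re, Complex.sub_re, Complex.mul_re, Complex.add_im,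
    Complex.sub_im, Complex.mul_im, Complex.conj_re, Complex.conj_im, Complex.ofReal_re,
    Complex.ofReal_im, Complex.star_def]
  ring

/-- The integrand is the derivative of Re Φ. At 1, Re Φ = -|v(1) - w(1)|²/2 ≤ 0. At 0, Φ vanishes
because w(0) = 0, which in the application is the boundary condition u₂'(0) = 0. -/
theorem energy_flux {v w : ℝ → ℂ} (hv : ContDiffOn ℝ 1 v (Icc (0 : ℝ) 1))
    (hw : ContDiffOn ℝ 1 w (Icc (0 : ℝ) 1)) (hw0 : w 0 = 0) :
    ∫ x in Ioo (0 : ℝ) 1, ((star (D v x) * w x + star (v x) * D w x) -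
      ((1 / 2 : ℝ) * (star (v x) * v x + star (w x) * w x) +
        (x / 2 : ℝ) * ((star (D v x) * v x + star (v x) * D v x) +
          (star (D w x) * w x + star (w x) * D w x)))).re ≤ 0 := by
  set Φ : ℝ → ℂ := fun x => star (v x) * w x -
    (x / 2 : ℝ) * (star (v x) * v x + star (w x) * w x) with hΦ
  have hx2 : Continuous fun x : ℝ => ((x / 2 : ℝ) : ℂ) := by fun_prop
  have cv := hv.continuousOn
  have cw := hw.continuousOn
  have cDv := continuousOn_D hv
  have cDw := continuousOn_D hw
  have hΦc : ContinuousOn Φ (Icc (0 : ℝ) 1) :=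
    (cv.star.mul cw).sub (hx2.continuousOn.mul ((cv.star.mul cv).add (cw.star.mul cw)))
  have hder : ∀ x ∈ Ioo (0 : ℝ) 1, HasDerivAt Φ
      ((star (D v x) * w x + star (v x) * D w x) -
      ((1 / 2 : ℝ) * (star (v x) * v x + star (w x) * w x) +
        (x / 2 : ℝ) * ((star (D v x) * v x + star (v x) * D v x) +
          (star (D w x) * w x + star (w x) * D w x)))) x := by
    intro x hx
    have h1 := hasDerivAt_D hv hx
    have h2 := hasDerivAt_D hw hx
    have h4 : HasDerivAt (fun y : ℝ => ((y / 2 : ℝ) : ℂ)) ((1 / 2 : ℝ) : ℂ) x :=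
      ((hasDerivAt_id x).div_const 2).ofReal_comp
    exact (h1.star.mul h2).sub (h4.mul ((h1.star.mul h1).add (h2.star.mul h2)))
  rw [← integral_Ioc_eq_integral_Ioo, ← intervalIntegral.integral_of_le zero_le_one]
  refine le_of_eq_of_le (intervalIntegral.integral_eq_sub_of_hasDerivAt_of_le zero_le_one
      (f := fun x => (Φ x).re) (Complex.continuous_re.comp_continuousOn hΦc)
      (fun x hx => Complex.reCLM.hasFDerivAt.comp_hasDerivAt x (hder x hx)) ?_) ?_
  rotate_left
  · simp only [hΦ, hw0]
    have : (0 : ℝ) ≤ ((v 1).re - (w 1).re) ^ 2 + ((v 1).im - (w 1).im) ^ 2 := by positivity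
    simp only [Complex.add_re, Complex.sub_re, Complex.mul_re, Complex.add_im,
      Complex.mul_im, Complex.conj_re, Complex.conj_im, Complex.ofReal_re,
      Complex.ofReal_im, Complex.star_def, Complex.zero_re, Complex.zero_im]
    nlinarith
  · refine ContinuousOn.intervalIntegrable ?_
    rw [uIcc_of_le zero_le_one]
    refine Complex.continuous_re.comp_continuousOn ?_
    exact ((cDv.star.mul cw).add (cv.star.mul cDw)).sub
      ((continuousOn_const.mul ((cv.star.mul cv).add (cw.star.mul cw))).add
        (hx2.continuousOn.mul (((cDv.star.mul cv).add (cv.star.mul cDv)).add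
          ((cDw.star.mul cw).add (cw.star.mul cDw)))))

theorem energy_estimate (p : ℝ) (f : ClassicalDomain) :
    (inner ℂ (comp1 (incl f)).wd (comp1 (freeAction p f)).wd +
      inner ℂ (comp2 (incl f)).wd (comp2 (freeAction p f)).wd).re ≤
    -((1 / 2 + 2 / (p - 1)) * (‖(comp1 (incl f)).wd‖ ^ 2 + ‖(comp2 (incl f)).wd‖ ^ 2)) := by
  have n1 : (inner ℂ (comp1 (incl f)).wd (comp1 (incl f)).wd).re =
      ‖(comp1 (incl f)).wd‖ ^ 2 := inner_self_eq_norm_sq (𝕜 := ℂ) _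
  have n2 : (inner ℂ (comp2 (incl f)).wd (comp2 (incl f)).wd).re =
      ‖(comp2 (incl f)).wd‖ ^ 2 := inner_self_eq_norm_sq (𝕜 := ℂ) _
  have e : (inner ℂ (comp1 (incl f)).wd (comp1 (freeAction p f)).wd +
      inner ℂ (comp2 (incl f)).wd (comp2 (freeAction p f)).wd).re +
      (1 / 2 + 2 / (p - 1)) * (inner ℂ (comp1 (incl f)).wd (comp1 (incl f)).wd +
        inner ℂ (comp2 (incl f)).wd (comp2 (incl f)).wd).re ≤ 0 := by
    have i1 := L2.integrable_inner (𝕜 := ℂ) (comp1 (incl f)).wd (comp1 (freeAction p f)).wd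
    have i2 := L2.integrable_inner (𝕜 := ℂ) (comp2 (incl f)).wd (comp2 (freeAction p f)).wd
    have i3 := L2.integrable_inner (𝕜 := ℂ) (comp1 (incl f)).wd (comp1 (incl f)).wd
    have i4 := L2.integrable_inner (𝕜 := ℂ) (comp2 (incl f)).wd (comp2 (incl f)).wd
    rw [L2.inner_def, L2.inner_def, L2.inner_def, L2.inner_def, ← integral_add i1 i2,
      ← integral_add i3 i4]
    have r1 := integral_re (𝕜 := ℂ) (i1.add i2)
    have r2 := integral_re (𝕜 := ℂ) (i3.add i4)
    have i5 := (i1.add i2).re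
    have i6 := (i3.add i4).re.const_mul (1 / 2 + 2 / (p - 1))
    simp only [Pi.add_apply, RCLike.re_eq_complex_re] at r1 r2 i5 i6
    rw [← r1, ← r2, ← integral_const_mul, ← integral_add i5 i6]
    refine le_trans (le_of_eq (integral_congr_ae ?_))
      (energy_flux (contDiffOn_D f.2.1) (contDiffOn_D f.2.2.1) f.2.2.2.2)
    filter_upwards [wd_ofC1 (c1 f), wd_ofC1 (c2 f), wd_ofC1 (e1 p f), wd_ofC1 (e2 p f),
      ae_restrict_mem measurableSet_Ioo] with x h1 h2 h3 h4 hx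
    rw [← energy_pointwise (D f.1.1 x) (D f.1.2 x) (D (D f.1.1) x) (D (D f.1.2) x) x
      (2 / (p - 1)), ← D_freeExpr p f.2.1 f.2.2.1 hx, ← D_freeExpr p f.2.2.1 f.2.1 hx,
      ← h1, ← h2, ← h3, ← h4]
    rfl
  rw [Complex.add_re (inner ℂ (comp1 (incl f)).wd (comp1 (incl f)).wd), n1, n2] at e
  linarith

/-! ### Polynomial elements of the classical domain -/

/-- Pairs of odd polynomials. -/
abbrev oddPair : Submodule ℂ (ℂ[X] × ℂ[X]) := oddPoly.prod oddPoly

theorem polyFn_zero_of_mem_oddPoly {U : ℂ[X]} (hU : U ∈ oddPoly) : polyFn U 0 = 0 := by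
  simp only [polyFn, Complex.ofReal_zero]
  rw [← coeff_zero_eq_eval_zero]
  exact hU 0 Even.zero

/-- The pair of odd polynomials `(U, V)` gives the classical functions `(U, V')`. -/
def polyCD : oddPair →ₗ[ℂ] ClassicalDomain where
  toFun q := ⟨(polyFn q.1.1, polyFn (derivative q.1.2)), (contDiff_polyFn _).contDiffOn,
    (contDiff_polyFn _).contDiffOn, polyFn_zero_of_mem_oddPoly q.2.1, by
      change D (polyFn (derivative q.1.2)) 0 = 0
      rw [D_polyFn _ ⟨le_rfl, zero_le_one⟩]
      simp only [polyFn, Complex.ofReal_zero]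
      -- V''(0) is twice the coefficient of X² in V, which is zero by parity.
      rw [← coeff_zero_eq_eval_zero, coeff_derivative, coeff_derivative, q.2.2 _ (by decide)]
      simp⟩
  map_add' q r := by
    refine Subtype.ext (Prod.ext ?_ ?_) <;> funext x <;> simp [polyFn]
  map_smul' c q := by
    refine Subtype.ext (Prod.ext ?_ ?_) <;> funext x <;> simp [polyFn]

/-- Elements of `𝓗` given by pairs of odd polynomials. -/
def polyH : oddPair →ₗ[ℂ] HSpace := incl ∘ₗ polyCD

theorem fn_comp1_polyH (q : oddPair) : (comp1 (polyH q)).fn = polyL2 q.1.1 := rfl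

theorem fn_comp2_polyH (q : oddPair) : (comp2 (polyH q)).fn = polyL2 (derivative q.1.2) := rfl

theorem wd_comp1_polyH (q : oddPair) : (comp1 (polyH q)).wd = polyL2 (derivative q.1.1) := by
  refine Lp.ext ?_
  filter_upwards [wd_ofC1 (c1 (polyCD q)), coeFn_polyL2 (derivative q.1.1),
    ae_restrict_mem measurableSet_Ioo] with x h1 h2 hx
  rw [h2, ← D_polyFn _ (Ioo_subset_Icc_self hx)]
  exact h1

theorem wd_comp2_polyH (q : oddPair) :
    (comp2 (polyH q)).wd = polyL2 (derivative (derivative q.1.2)) := by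
  refine Lp.ext ?_
  filter_upwards [wd_ofC1 (c2 (polyCD q)), coeFn_polyL2 (derivative (derivative q.1.2)),
    ae_restrict_mem measurableSet_Ioo] with x h1 h2 hx
  rw [h2, ← D_polyFn _ (Ioo_subset_Icc_self hx)]
  exact h1

theorem integral_polyFn_derivative (V : ℂ[X]) (x : ℝ) :
    ∫ s in (0 : ℝ)..x, polyFn (derivative V) s = polyFn V x - polyFn V 0 :=
  intervalIntegral.integral_eq_sub_of_hasDerivAt (fun y _ => hasDerivAt_polyFn V y)
    ((contDiff_polyFn (derivative V) (n := 0)).continuous.intervalIntegrable _ _)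

theorem fn_primH1_polyL2_derivative {V : ℂ[X]} (hV : V ∈ oddPoly) :
    (primH1 (polyL2 (derivative V))).fn = polyL2 V := by
  refine Lp.ext ?_
  filter_upwards [fn_primH1 (polyL2 (derivative V)), coeFn_polyL2 V,
    ae_restrict_mem measurableSet_Ioo] with x h1 h2 hx
  rw [h1, h2, primitive_congr (coeFn_polyL2 _) (Ioo_subset_Icc_self hx),
    integral_polyFn_derivative, polyFn_zero_of_mem_oddPoly hV, sub_zero]

theorem polyL2_injective : Function.Injective polyL2 := by
  rw [injective_iff_map_eq_zero]
  intro P hP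
  have h1 : polyFn P =ᵐ[mu01] fun _ => 0 := by
    have := coeFn_polyL2 P
    rw [hP] at this
    exact this.symm.trans (Lp.coeFn_zero ℂ 2 mu01)
  have h2 := Measure.eqOn_Ioo_of_ae_eq volume h1
    (contDiff_polyFn P (n := 0)).continuous.continuousOn continuousOn_const
  refine eq_zero_of_infinite_isRoot P (Infinite.mono (s := (fun x : ℝ => (x : ℂ)) '' Ioo 0 1) ?_ ?_)
  · rintro _ ⟨x, hx, rfl⟩
    exact h2 hx
  · exact (Ioo_infinite zero_lt_one).image Complex.ofReal_injective.injOn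

/-! ### The action of `λ - L` on the classical domain and on polynomials -/

/-- The classical action of `z - L`. -/
def shiftAction (p : ℝ) (z : ℂ) : ClassicalDomain →ₗ[ℂ] HSpace :=
  z • incl - freeAction p - perturbation p ∘ₗ incl

theorem shiftAction_apply (p : ℝ) (z : ℂ) (f : ClassicalDomain) :
    shiftAction p z f = z • incl f - freeAction p f - perturbation p (incl f) := rfl

/-- The action of `z - L` in terms of pairs of odd polynomials. -/
def polyAction (p : ℝ) (z : ℂ) (q : ℂ[X] × ℂ[X]) : ℂ[X] × ℂ[X] :=
  ((z + (2 / (p - 1) : ℝ)) • q.1 + X * derivative q.1 - derivative (derivative q.2)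
      - ((p * kappa p : ℝ) : ℂ) • q.2,
    (z + (2 / (p - 1) : ℝ) - 1) • q.2 + X * derivative q.2 - q.1)

theorem coeff_X_mul_derivative (P : ℂ[X]) (n : ℕ) : (X * derivative P).coeff n = n * P.coeff n := by
  cases n with
  | zero => simp
  | succ n => rw [coeff_X_mul, coeff_derivative]; push_cast; ring

theorem polyAction_coeff_fst (p : ℝ) (z : ℂ) (q : ℂ[X] × ℂ[X]) (n : ℕ) :
    (polyAction p z q).1.coeff n = (z + (2 / (p - 1) : ℝ) + n) * q.1.coeff n -
      (n + 2) * (n + 1) * q.2.coeff (n + 2) - ((p * kappa p : ℝ) : ℂ) * q.2.coeff n := by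
  simp only [polyAction, coeff_sub, coeff_add, coeff_smul, coeff_X_mul_derivative,
    coeff_derivative, smul_eq_mul]
  push_cast
  ring

theorem polyAction_coeff_snd (p : ℝ) (z : ℂ) (q : ℂ[X] × ℂ[X]) (n : ℕ) :
    (polyAction p z q).2.coeff n = (z + (2 / (p - 1) : ℝ) - 1 + n) * q.2.coeff n -
      q.1.coeff n := by
  simp only [polyAction, coeff_sub, coeff_add, coeff_smul, coeff_X_mul_derivative, smul_eq_mul]
  ring

theorem polyAction_mem_oddPair (p : ℝ) (z : ℂ) {q : ℂ[X] × ℂ[X]} (hq : q ∈ oddPair) :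
    polyAction p z q ∈ oddPair := by
  constructor <;> intro n hn
  · rw [polyAction_coeff_fst, hq.1 n hn, hq.2 n hn, hq.2 (n + 2) (by simpa [Nat.even_add] using hn)]
    simp
  · rw [polyAction_coeff_snd, hq.1 n hn, hq.2 n hn]
    simp

/-- Pairs of odd polynomials of degree less than `N`. -/
abbrev oddPairLT (N : ℕ) : Submodule ℂ (ℂ[X] × ℂ[X]) := (oddLT N).prod (oddLT N)

theorem oddPairLT_le (N : ℕ) : oddPairLT N ≤ oddPair := fun _ hq => ⟨hq.1.1, hq.2.1⟩

theorem mem_degreeLT_iff_coeff {P : ℂ[X]} {N : ℕ} :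
    P ∈ degreeLT ℂ N ↔ ∀ n, N ≤ n → P.coeff n = 0 := by
  rw [mem_degreeLT, degree_lt_iff_coeff_zero]

/-- No term of the action raises the degree or changes the parity. This gives the finite-dimensional
invariant blocks on which the whole proof rests. -/
theorem polyAction_mem_oddPairLT (p : ℝ) (z : ℂ) {N : ℕ} {q : ℂ[X] × ℂ[X]}
    (hq : q ∈ oddPairLT N) : polyAction p z q ∈ oddPairLT N := by
  have ho := polyAction_mem_oddPair p z (oddPairLT_le N hq)
  have h1 := mem_degreeLT_iff_coeff.1 hq.1.2
  have h2 := mem_degreeLT_iff_coeff.1 hq.2.2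
  refine ⟨⟨ho.1, mem_degreeLT_iff_coeff.2 fun n hn => ?_⟩,
    ⟨ho.2, mem_degreeLT_iff_coeff.2 fun n hn => ?_⟩⟩
  · rw [polyAction_coeff_fst, h1 n hn, h2 n hn, h2 (n + 2) (by omega)]
    simp
  · rw [polyAction_coeff_snd, h1 n hn, h2 n hn]
    simp

/-- Recording the second component through its odd primitive V makes the integral in L' equal to V
itself, so `z - L` acts on pairs of odd polynomials. -/
theorem shiftAction_polyCD (p : ℝ) (z : ℂ) (q : oddPair) :
    shiftAction p z (polyCD q) = polyH ⟨polyAction p z q, polyAction_mem_oddPair p z q.2⟩ := by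
  have hF1 : (comp1 (freeAction p (polyCD q))).fn = polyL2 (derivative (derivative q.1.2) -
      X * derivative q.1.1 - ((2 / (p - 1) : ℝ) : ℂ) • q.1.1) := by
    refine Lp.ext ?_
    filter_upwards [fn_ofC1 (e1 p (polyCD q)), coeFn_polyL2 (derivative (derivative q.1.2) -
      X * derivative q.1.1 - ((2 / (p - 1) : ℝ) : ℂ) • q.1.1),
      ae_restrict_mem measurableSet_Ioo] with x h1 h2 hx
    rw [h2]
    refine h1.trans ?_
    have hx' := Ioo_subset_Icc_self hx
    change D (polyFn (derivative q.1.2)) x - (x : ℂ) * D (polyFn q.1.1) x -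
      ((2 / (p - 1) : ℝ) : ℂ) * polyFn q.1.1 x = _
    rw [D_polyFn _ hx', D_polyFn _ hx']
    simp [polyFn]
  have hF2 : (comp2 (freeAction p (polyCD q))).fn = polyL2 (derivative q.1.1 -
      X * derivative (derivative q.1.2) - ((2 / (p - 1) : ℝ) : ℂ) • derivative q.1.2) := by
    refine Lp.ext ?_
    filter_upwards [fn_ofC1 (e2 p (polyCD q)), coeFn_polyL2 (derivative q.1.1 -
      X * derivative (derivative q.1.2) - ((2 / (p - 1) : ℝ) : ℂ) • derivative q.1.2),
      ae_restrict_mem measurableSet_Ioo] with x h1 h2 hx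
    rw [h2]
    refine h1.trans ?_
    have hx' := Ioo_subset_Icc_self hx
    change D (polyFn q.1.1) x - (x : ℂ) * D (polyFn (derivative q.1.2)) x -
      ((2 / (p - 1) : ℝ) : ℂ) * polyFn (derivative q.1.2) x = _
    rw [D_polyFn _ hx', D_polyFn _ hx']
    simp [polyFn]
  have hP1 : (comp1 (perturbation p (polyH q))).fn = polyL2 (((p * kappa p : ℝ) : ℂ) • q.1.2) := by
    change ((p * kappa p : ℝ) : ℂ) • (primH1 (comp2 (polyH q)).fn).fn = _
    rw [fn_comp2_polyH, fn_primH1_polyL2_derivative q.2.2, map_smul]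
  have hP2 : (comp2 (perturbation p (polyH q))).fn = 0 := by
    change ((p * kappa p : ℝ) : ℂ) • (0 : L2) = _
    rw [smul_zero]
  refine HSpace.ext_fn ?_ ?_
  · rw [fn_comp1_polyH, shiftAction_apply]
    simp only [comp1_sub, comp1_smul, H1.fn_sub, H1.fn_smul, hF1]
    change z • (comp1 (polyH q)).fn - _ - (comp1 (perturbation p (polyH q))).fn = _
    rw [hP1, fn_comp1_polyH, ← map_smul, ← map_sub, ← map_sub]
    congr 1
    simp only [polyAction, add_smul]
    abel
  · rw [fn_comp2_polyH, shiftAction_apply]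
    simp only [comp2_sub, comp2_smul, H1.fn_sub, H1.fn_smul, hF2]
    change z • (comp2 (polyH q)).fn - _ - (comp2 (perturbation p (polyH q))).fn = _
    rw [hP2, sub_zero, fn_comp2_polyH, ← map_smul, ← map_sub]
    congr 1
    -- The second entry of `polyAction` is again a primitive. Since (XV')' = V' + XV'', its
    -- V-coefficient carries the shift -1.
    simp only [polyAction, add_smul, sub_smul, one_smul, derivative_sub, derivative_add,
      derivative_smul, derivative_mul, derivative_X, one_mul]
    abel

theorem polyH_injective_of_fn {q : oddPair} (h1 : (comp1 (polyH q)).fn = 0)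
    (h2 : (comp2 (polyH q)).fn = 0) : q = 0 := by
  rw [fn_comp1_polyH] at h1
  rw [fn_comp2_polyH] at h2
  have k1 : q.1.1 = 0 := polyL2_injective (by rw [h1, map_zero])
  have k2 : q.1.2 = 0 := by
    apply polyL2_injective
    rw [← fn_primH1_polyL2_derivative q.2.2, h2, map_zero, ← primCLM_apply, map_zero, H1.fn_zero]
  exact Subtype.ext (Prod.ext k1 k2)

/-! ### Estimate modulo polynomials -/

theorem exists_oddLT_orthogonal (T : ℂ[X] →ₗ[ℂ] L2) (N : ℕ) (v : L2) :
    ∃ U ∈ oddLT N, ∀ P ∈ oddLT N, inner ℂ (v - T U) (T P) = 0 := by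
  obtain ⟨_, ⟨U, hU, rfl⟩, z, hz, hv⟩ :=
    Submodule.exists_add_mem_mem_orthogonal (K := (oddLT N).map T) v
  refine ⟨U, hU, fun P hP => ?_⟩
  rw [hv, add_sub_cancel_left]
  exact (Submodule.mem_orthogonal' _ _).1 hz _ ⟨P, hP, rfl⟩

theorem monomial_one_mem_oddLT {N : ℕ} (hN : 2 ≤ N) (c : ℂ) : monomial 1 c ∈ oddLT N :=
  ⟨monomial_mem_oddPoly odd_one c, mem_degreeLT.2
    ((degree_monomial_le _ _).trans_lt (by exact_mod_cast hN))⟩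

/-- A classical element becomes orthogonal at the level of derivatives to the polynomials of
bounded degree upon subtraction of a suitable polynomial element. -/
theorem exists_polyCD_orthogonal {N : ℕ} (hN : 2 ≤ N) (f : ClassicalDomain) :
    ∃ q : oddPair, q.1 ∈ oddPairLT N ∧
      (∀ P ∈ oddLT N, inner ℂ (comp1 (incl (f - polyCD q))).wd (polyL2 (derivative P)) = 0) ∧
      (∀ P ∈ oddLT N,
        inner ℂ (comp2 (incl (f - polyCD q))).wd (polyL2 (derivative (derivative P))) = 0) ∧
      comp2 (incl (f - polyCD q)) = primH1 (comp2 (incl (f - polyCD q))).wd := by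
  obtain ⟨U, hU, hU'⟩ := exists_oddLT_orthogonal (polyL2 ∘ₗ derivative) N (comp1 (incl f)).wd
  obtain ⟨V, hV, hV'⟩ := exists_oddLT_orthogonal (polyL2 ∘ₗ derivative ∘ₗ derivative) N
    (comp2 (incl f)).wd
  -- Adding kX to V changes V' by the constant k and leaves V'' alone. This k makes the second
  -- component of the difference vanish at 0 without disturbing the orthogonality.
  set k : ℂ := f.1.2 0 - polyFn (derivative V) 0 with hk
  have hW : V + monomial 1 k ∈ oddLT N := Submodule.add_mem _ hV (monomial_one_mem_oddLT hN k)
  set q : oddPair := ⟨(U, V + monomial 1 k), hU.1, hW.1⟩ with hq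
  have e1 : (comp1 (incl (f - polyCD q))).wd =
      (comp1 (incl f)).wd - polyL2 (derivative U) := by
    rw [map_sub, comp1_sub, H1.wd_sub]
    exact congrArg _ (wd_comp1_polyH q)
  have e2 : (comp2 (incl (f - polyCD q))).wd =
      (comp2 (incl f)).wd - polyL2 (derivative (derivative V)) := by
    rw [map_sub, comp2_sub, H1.wd_sub]
    refine congrArg _ ((wd_comp2_polyH q).trans ?_)
    simp [hq]
  refine ⟨q, ⟨hU, hW⟩, fun P hP => ?_, fun P hP => ?_, ?_⟩
  · rw [e1]; exact hU' P hP
  · rw [e2]; exact hV' P hP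
  · refine eq_primH1_of_vanishesAtZero ⟨(f - polyCD q).1.2, (c2 (f - polyCD q)).continuousOn,
      fn_ofC1 (c2 (f - polyCD q)), ?_⟩
    change f.1.2 0 - polyFn (derivative (V + monomial 1 k)) 0 = 0
    rw [derivative_add, derivative_monomial]
    simp [polyFn, hk]

/-- With t² + s² ≥ (t+s)²/2 and ts ≤ (t+s)²/4 the left side is at least (3/16)(t+s)², and 16/3 < 6.
-/
theorem energy_algebra {t s F r : ℝ} (hF : 0 ≤ F) (hr : 0 ≤ r)
    (h : (1 / 2 + r) * (t ^ 2 + s ^ 2) - 1 / 4 * (t * s) ≤ F * (t + s)) : t + s ≤ 6 * F := by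
  by_contra hcon
  push Not at hcon
  have h1 : 0 < t + s := lt_of_le_of_lt (by positivity) hcon
  nlinarith [mul_nonneg hr (add_nonneg (sq_nonneg t) (sq_nonneg s)), sq_nonneg (t - s),
    mul_lt_mul_of_pos_right hcon h1]

theorem wd_comp1_perturbation (p : ℝ) (u : HSpace) :
    (comp1 (perturbation p u)).wd = ((p * kappa p : ℝ) : ℂ) • (comp2 u).fn := rfl

theorem wd_comp2_perturbation (p : ℝ) (u : HSpace) :
    (comp2 (perturbation p u)).wd = 0 := by
  change ((p * kappa p : ℝ) : ℂ) • (0 : L2) = 0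
  rw [smul_zero]

/-- Up to polynomials of bounded degree, classical elements are controlled by the action of
`z - L`, with the degree independent of `z`. -/
theorem exists_oddPairLT_near (p : ℝ) : ∃ N, ∀ z : ℂ, 0 ≤ z.re + 2 / (p - 1) →
    ∀ f : ClassicalDomain, ∃ q : oddPair, q.1 ∈ oddPairLT N ∧
      ‖incl f - polyH q‖ ≤ 12 * ‖shiftAction p z f‖ := by
  set c : ℝ := p * kappa p with hc
  -- This ε satisfies |c|ε ≤ 1/4, so the cross term is absorbed by the energy gain 1/2.
  obtain ⟨N₀, hN₀⟩ := exists_oddLT_near_primH1 (ε := 1 / (4 * (|c| + 1))) (by positivity)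
  refine ⟨max N₀ 2, fun z hz f => ?_⟩
  obtain ⟨q, hq, ho1, ho2, hprim⟩ := exists_polyCD_orthogonal (le_max_right N₀ 2) f
  refine ⟨q, hq, ?_⟩
  set g := f - polyCD q with hg
  set v := (comp1 (incl g)).wd with hv
  set w := (comp2 (incl g)).wd with hw
  set F := shiftAction p z f with hF
  have hx : incl f - polyH q = incl g := (map_sub incl _ _).symm
  have hy : shiftAction p z g =
      F - polyH ⟨polyAction p z q, polyAction_mem_oddPair p z q.2⟩ := by
    rw [hg, map_sub, shiftAction_polyCD]
  -- By invariance the subtracted polynomial part has an image of degree less than N. The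
  -- derivatives of that image are orthogonal to v and w, so the pairings see only F.
  have hM := polyAction_mem_oddPairLT p z hq
  -- the action of `z - L` on the difference, tested against its derivatives
  have t1 : inner ℂ v (comp1 (shiftAction p z g)).wd = inner ℂ v (comp1 F).wd := by
    rw [hy, comp1_sub, H1.wd_sub, inner_sub_right, wd_comp1_polyH, ho1 _ hM.1, sub_zero]
  have t2 : inner ℂ w (comp2 (shiftAction p z g)).wd = inner ℂ w (comp2 F).wd := by
    rw [hy, comp2_sub, H1.wd_sub, inner_sub_right, wd_comp2_polyH, ho2 _ hM.2, sub_zero]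
  have s1 : inner ℂ v (comp1 (shiftAction p z g)).wd = z * inner ℂ v v -
      inner ℂ v (comp1 (freeAction p g)).wd - (c : ℂ) * inner ℂ v (comp2 (incl g)).fn := by
    rw [shiftAction_apply]
    simp only [comp1_sub, comp1_smul, H1.wd_sub, H1.wd_smul, inner_sub_right, inner_smul_right,
      wd_comp1_perturbation]
    rfl
  have s2 : inner ℂ w (comp2 (shiftAction p z g)).wd = z * inner ℂ w w -
      inner ℂ w (comp2 (freeAction p g)).wd := by
    rw [shiftAction_apply]
    simp only [comp2_sub, comp2_smul, H1.wd_sub, H1.wd_smul, inner_sub_right, inner_smul_right,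
      wd_comp2_perturbation, sub_zero]
    rfl
  have nv : inner ℂ v v = ((‖v‖ ^ 2 : ℝ) : ℂ) := by
    rw [inner_self_eq_norm_sq_to_K]; norm_cast
  have nw : inner ℂ w w = ((‖w‖ ^ 2 : ℝ) : ℂ) := by
    rw [inner_self_eq_norm_sq_to_K]; norm_cast
  have hcross : ‖(c : ℂ) * inner ℂ v (comp2 (incl g)).fn‖ ≤ 1 / 4 * (‖v‖ * ‖w‖) := by
    obtain ⟨U, hU, hUw⟩ := hN₀ w
    -- Orthogonality of v allows the primitive of w to be replaced by its small distance to a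
    -- polynomial.
    have e : inner ℂ v (comp2 (incl g)).fn = inner ℂ v ((primH1 w).fn - polyL2 (derivative U)) := by
      rw [inner_sub_right, ho1 U (oddLT_mono (le_max_left _ _) hU), sub_zero, hprim]
    rw [e, norm_mul, Complex.norm_real, Real.norm_eq_abs]
    have h1 := (norm_inner_le_norm (𝕜 := ℂ) v ((primH1 w).fn - polyL2 (derivative U))).trans
      (mul_le_mul_of_nonneg_left hUw (norm_nonneg v))
    have h2 : |c| * (1 / (4 * (|c| + 1))) ≤ 1 / 4 := by
      rw [mul_one_div, div_le_div_iff₀ (by positivity) (by norm_num)]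
      linarith
    calc _ ≤ |c| * (‖v‖ * (1 / (4 * (|c| + 1)) * ‖w‖)) :=
          mul_le_mul_of_nonneg_left h1 (abs_nonneg c)
      _ = (|c| * (1 / (4 * (|c| + 1)))) * (‖v‖ * ‖w‖) := by ring
      _ ≤ _ := mul_le_mul_of_nonneg_right h2 (by positivity)
  have hup1 := (Complex.re_le_norm (inner ℂ v (comp1 F).wd)).trans
    (norm_inner_le_norm v (comp1 F).wd)
  have hup2 := (Complex.re_le_norm (inner ℂ w (comp2 F).wd)).trans
    (norm_inner_le_norm w (comp2 F).wd)
  have f1 := (H1.norm_wd_le (comp1 F)).trans (norm_comp1_le F)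
  have f2 := (H1.norm_wd_le (comp2 F)).trans (norm_comp2_le F)
  have hE := energy_estimate p g
  rw [← t1, s1, nv] at hup1
  rw [← t2, s2, nw] at hup2
  have hc' := (Complex.re_le_norm _).trans hcross
  simp only [Complex.sub_re, Complex.add_re, Complex.re_mul_ofReal] at hup1 hup2 hE
  have hsum : ‖v‖ + ‖w‖ ≤ 6 * ‖F‖ := by
    refine energy_algebra (r := z.re + 2 / (p - 1)) (norm_nonneg F) hz ?_
    have g1 := mul_le_mul_of_nonneg_left f1 (norm_nonneg v)
    have g2 := mul_le_mul_of_nonneg_left f2 (norm_nonneg w)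
    linarith
  rw [hx]
  -- The constant 12 is 2 · 6: the derivatives control the full norm up to the factor 2.
  linarith [norm_le_of_eq_primH1 hprim]

/-! ### The kernel of `z - L` on polynomials -/

theorem mul_kappa {p : ℝ} (hp : 3 < p) :
    p * kappa p = (2 / (p - 1) + 1) * (2 / (p - 1) + 2) := by
  have : p - 1 ≠ 0 := by linarith
  rw [kappa]
  field_simp
  ring

/-- The second equation gives uₙ = (z+a+n-1)vₙ. Inserted into the first, it produces
(z+a+n)(z+a+n-1) - (a+1)(a+2), which factors as stated thanks to `mul_kappa`. -/
theorem coeff_recursion {p : ℝ} (hp : 3 < p) {z : ℂ} {q : ℂ[X] × ℂ[X]}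
    (h : polyAction p z q = 0) (n : ℕ) :
    (z + n - 2) * (z + 2 * (2 / (p - 1) : ℝ) + n + 1) * q.2.coeff n =
      (n + 2) * (n + 1) * q.2.coeff (n + 2) := by
  have h1 := polyAction_coeff_fst p z q n
  have h2 := polyAction_coeff_snd p z q n
  rw [h, mul_kappa hp] at h1
  rw [h] at h2
  simp only [Prod.fst_zero, Prod.snd_zero, coeff_zero] at h1 h2
  push_cast at h1 h2 ⊢
  linear_combination (-1 : ℂ) * h1 - (z + 2 / ((p : ℂ) - 1) + n) * h2

/-- At the top degree n the recursion has zero right side, so one of the two factors vanishes. The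
second has positive real part; the first gives n = 2 - Re z < 3, and n is odd. -/
theorem natDegree_of_polyAction_eq_zero {p : ℝ} (hp : 3 < p) {z : ℂ}
    (hz : 0 < z.re + 2 / (p - 1)) {q : ℂ[X] × ℂ[X]} (hq : q ∈ oddPair)
    (h : polyAction p z q = 0) (h0 : q.2 ≠ 0) : q.2.natDegree = 1 ∧ z = 1 := by
  have ha : 2 / (p - 1) < 1 := by rw [div_lt_one (by linarith)]; linarith
  have ha0 : 0 < 2 / (p - 1) := div_pos two_pos (by linarith)
  set n := q.2.natDegree with hn
  have hlead : q.2.coeff n ≠ 0 := by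
    rw [hn, coeff_natDegree]; exact leadingCoeff_ne_zero.2 h0
  have hodd : Odd n := Nat.not_even_iff_odd.1 fun he => hlead (hq.2 n he)
  have hr := coeff_recursion hp h n
  rw [coeff_eq_zero_of_natDegree_lt (by omega : q.2.natDegree < n + 2), mul_zero, mul_eq_zero,
    or_iff_left hlead, mul_eq_zero] at hr
  rcases hr with hr | hr
  · have hre := congrArg Complex.re hr
    simp at hre
    have hlt : (n : ℝ) < 3 := by linarith
    have hn3 : n < 3 := by exact_mod_cast hlt
    have hn1 : n = 1 := by
      obtain ⟨k, hk⟩ := hodd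
      omega
    refine ⟨hn1, ?_⟩
    rw [hn1] at hr
    push_cast at hr
    linear_combination hr
  · exfalso
    have hre := congrArg Complex.re hr
    rw [Complex.add_re, Complex.add_re, Complex.add_re, ← Complex.ofReal_ofNat,
      ← Complex.ofReal_mul, Complex.ofReal_re, Complex.natCast_re, Complex.one_re,
      Complex.zero_re] at hre
    have : (0 : ℝ) ≤ n := Nat.cast_nonneg n
    linarith

theorem eq_zero_of_polyAction_eq_zero {p : ℝ} (hp : 3 < p) {z : ℂ}
    (hz : 0 < z.re + 2 / (p - 1)) (hz1 : z ≠ 1) {q : ℂ[X] × ℂ[X]} (hq : q ∈ oddPair)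
    (h : polyAction p z q = 0) : q = 0 := by
  have h2 : q.2 = 0 := by
    by_contra h0
    exact hz1 (natDegree_of_polyAction_eq_zero hp hz hq h h0).2
  have h1 := congrArg Prod.snd h
  simp only [polyAction, h2, smul_zero, derivative_zero, mul_zero, add_zero, zero_sub,
    Prod.snd_zero, neg_eq_zero] at h1
  exact Prod.ext h1 h2

/-- Degree at most 1 and oddness leave V = kX, and the second equation reads U = aV + XV' = (1+a)kX.
-/
theorem exists_eq_of_polyAction_one_eq_zero {p : ℝ} (hp : 3 < p) {q : ℂ[X] × ℂ[X]}
    (hq : q ∈ oddPair) (h : polyAction p 1 q = 0) :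
    ∃ k : ℂ, q = k • ((((p + 1) / (p - 1) : ℝ) : ℂ) • X, X) := by
  have ha0 : 0 < 2 / (p - 1) := div_pos two_pos (by linarith)
  have hdeg : q.2.natDegree ≤ 1 := by
    by_cases h0 : q.2 = 0
    · simp [h0]
    · exact (natDegree_of_polyAction_eq_zero hp (by simpa using by linarith) hq h h0).1.le
  obtain ⟨k, b, hkb⟩ := exists_eq_X_add_C_of_natDegree_le_one hdeg
  have hb : b = 0 := by simpa [hkb] using hq.2 0 Even.zero
  rw [hb, C_0, add_zero] at hkb
  refine ⟨k, Prod.ext ?_ ?_⟩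
  · have h1 := congrArg Prod.snd h
    simp only [polyAction, Prod.snd_zero, sub_eq_zero] at h1
    rw [← h1, hkb]
    have e : (((p + 1) / (p - 1) : ℝ) : ℂ) = 1 + (2 / (p - 1) : ℝ) := by
      have : p - 1 ≠ 0 := by linarith
      rw [← Complex.ofReal_one, ← Complex.ofReal_add]
      congr 1
      field_simp
      ring
    rw [e]
    simp only [derivative_mul, derivative_C, zero_mul, derivative_X, mul_one, zero_add,
      Prod.smul_fst, smul_eq_C_mul, ← mul_assoc, map_add, map_sub]
    simp only [C_1]
    ring
  · rw [hkb, Prod.smul_snd, smul_eq_C_mul]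

/-! ### The resolvent estimate on the classical domain -/

theorem exists_norm_le_of_injective {V E F : Type*} [AddCommGroup V] [Module ℂ V]
    [FiniteDimensional ℂ V] [NormedAddCommGroup E] [NormedSpace ℂ E] [NormedAddCommGroup F]
    [NormedSpace ℂ F] (S : V →ₗ[ℂ] E) (T : V →ₗ[ℂ] F) (hT : Function.Injective T) :
    ∃ C : ℝ, 0 ≤ C ∧ ∀ x, ‖S x‖ ≤ C * ‖T x‖ := by
  set e := LinearEquiv.ofInjective T hT with he
  have : FiniteDimensional ℂ (LinearMap.range T) := inferInstance
  set A : LinearMap.range T →L[ℂ] E := LinearMap.toContinuousLinearMap (S ∘ₗ e.symm.toLinearMap)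
    with hA
  refine ⟨‖A‖, A.opNorm_nonneg, fun x => ?_⟩
  have h1 := A.le_opNorm (e x)
  have h2 : A (e x) = S x := by simp [hA]
  rw [h2] at h1
  exact h1

instance (N : ℕ) : FiniteDimensional ℂ (oddPairLT N) :=
  Module.Finite.iff_fg.2 (Submodule.FG.prod (Module.Finite.iff_fg.1 inferInstance)
    (Module.Finite.iff_fg.1 inferInstance))

/-- The pair of underlying `L²` functions of an element of `𝓗`. -/
def fnMap : HSpace →ₗ[ℂ] L2 × L2 where
  toFun u := ((comp1 u).fn, (comp2 u).fn)
  map_add' _ _ := rfl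
  map_smul' _ _ := rfl

theorem norm_fnMap_le (u : HSpace) : ‖fnMap u‖ ≤ ‖u‖ :=
  max_le ((H1.norm_fn_le _).trans (norm_comp1_le u)) ((H1.norm_fn_le _).trans (norm_comp2_le u))

theorem fnMap_injective : Function.Injective fnMap := fun u v h => by
  have h' : ((comp1 u).fn, (comp2 u).fn) = ((comp1 v).fn, (comp2 v).fn) := h
  exact HSpace.ext_fn (Prod.mk.inj h').1 (Prod.mk.inj h').2

theorem norm_fnMap_freeAction_le (p : ℝ) (f : ClassicalDomain) :
    ‖fnMap (freeAction p f)‖ ≤ (2 + |2 / (p - 1)|) * ‖incl f‖ :=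
  max_le (norm_freeAction_le p f).1 (norm_freeAction_le p f).2

/-- `z - L` loses a derivative, but it is bounded from the norm of 𝓗 to that of L² × L². The weaker
norm is what allows polynomial part and rest to be estimated separately. -/
theorem norm_fnMap_shiftAction_le (p : ℝ) (z : ℂ) (f : ClassicalDomain) :
    ‖fnMap (shiftAction p z f)‖ ≤
      (‖z‖ + (2 + |2 / (p - 1)|) + ‖perturbationCLM p‖) * ‖incl f‖ := by
  rw [shiftAction_apply, map_sub, map_sub, map_smul]
  have h1 := norm_sub_le (z • fnMap (incl f) - fnMap (freeAction p f))
    (fnMap (perturbation p (incl f)))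
  have h2 := norm_sub_le (z • fnMap (incl f)) (fnMap (freeAction p f))
  have h3 := norm_fnMap_freeAction_le p f
  have h4 := (norm_fnMap_le (perturbation p (incl f))).trans
    ((perturbationCLM p).le_opNorm (incl f))
  have h5 := mul_le_mul_of_nonneg_left (norm_fnMap_le (incl f)) (norm_nonneg z)
  rw [norm_smul] at h2
  linarith

theorem polyH_injective : Function.Injective polyH := by
  rw [injective_iff_map_eq_zero]
  intro q hq
  exact polyH_injective_of_fn (by rw [hq]; rfl) (by rw [hq]; rfl)

theorem eq_zero_of_shiftAction_polyCD_eq_zero {p : ℝ} (hp : 3 < p) {z : ℂ}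
    (hz : 0 < z.re + 2 / (p - 1)) (hz1 : z ≠ 1) {q : oddPair}
    (h : shiftAction p z (polyCD q) = 0) : q = 0 := by
  rw [shiftAction_polyCD, ← map_zero polyH] at h
  exact Subtype.ext (eq_zero_of_polyAction_eq_zero hp hz hz1 q.2
    (congrArg Subtype.val (polyH_injective h)))

/-- Split f into a polynomial q of bounded degree and a rest of norm at most 12‖(z-L)f‖. On the
finite-dimensional block injectivity bounds q by the L² norm of (z-L)q, which differs from (z-L)f by
at most K times the norm of the rest. -/
theorem exists_norm_incl_le {p : ℝ} (hp : 3 < p) {z : ℂ} (hz : 0 < z.re + 2 / (p - 1))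
    (hz1 : z ≠ 1) : ∃ C : ℝ, 0 ≤ C ∧ ∀ f, ‖incl f‖ ≤ C * ‖shiftAction p z f‖ := by
  obtain ⟨N, hN⟩ := exists_oddPairLT_near p
  set ι := Submodule.inclusion (oddPairLT_le N) with hι
  obtain ⟨C, hC, hC'⟩ := exists_norm_le_of_injective (polyH ∘ₗ ι)
    (fnMap ∘ₗ shiftAction p z ∘ₗ polyCD ∘ₗ ι) (by
      rw [injective_iff_map_eq_zero]
      intro q hq
      have h1 : shiftAction p z (polyCD (ι q)) = 0 :=
        fnMap_injective (hq.trans (map_zero fnMap).symm)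
      have h2 := eq_zero_of_shiftAction_polyCD_eq_zero hp hz hz1 h1
      exact Subtype.ext (show q.1 = 0 from congrArg Subtype.val h2))
  set K := ‖z‖ + (2 + |2 / (p - 1)|) + ‖perturbationCLM p‖ with hK
  have hK0 : 0 ≤ K := by positivity
  refine ⟨12 + C * (1 + K * 12), by positivity, fun f => ?_⟩
  obtain ⟨q, hq, hfq⟩ := hN z hz.le f
  have h1 : ‖polyH q‖ ≤ C * ‖fnMap (shiftAction p z (polyCD q))‖ := hC' ⟨q.1, hq⟩
  have h2 : fnMap (shiftAction p z (polyCD q)) =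
      fnMap (shiftAction p z f) - fnMap (shiftAction p z (f - polyCD q)) := by
    rw [← map_sub, ← map_sub, sub_sub_cancel]
  have h3 := norm_sub_le (fnMap (shiftAction p z f)) (fnMap (shiftAction p z (f - polyCD q)))
  have h4 := norm_fnMap_shiftAction_le p z (f - polyCD q)
  have h5 := norm_fnMap_le (shiftAction p z f)
  have h6 : incl (f - polyCD q) = incl f - polyH q := map_sub _ _ _
  rw [h6, ← hK] at h4
  rw [← h2] at h3
  have h7 := mul_le_mul_of_nonneg_left hfq hK0
  have h8 : ‖polyH q‖ ≤ C * (1 + K * 12) * ‖shiftAction p z f‖ := by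
    refine h1.trans ?_
    rw [mul_assoc]
    refine mul_le_mul_of_nonneg_left ?_ hC
    linarith
  have h9 : ‖incl f‖ ≤ ‖incl f - polyH q‖ + ‖polyH q‖ := by
    simpa using norm_add_le (incl f - polyH q) (polyH q)
  linarith

/-! ### Density of polynomials in `𝓗` -/

theorem polyH_eq_assemble (q : oddPair) :
    polyH q = assemble (polyL2 (derivative q.1.1), polyFn (derivative q.1.2) 0,
      polyL2 (derivative (derivative q.1.2))) := by
  refine HSpace.ext_fn ?_ ?_
  · rw [comp1_assemble, fn_primH1_polyL2_derivative q.2.1, fn_comp1_polyH]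
  · rw [comp2_assemble, fn_comp2_polyH, H1.fn_add]
    refine Lp.ext ?_
    filter_upwards [Lp.coeFn_add (constH1 (polyFn (derivative q.1.2) 0)).fn
      (primH1 (polyL2 (derivative (derivative q.1.2)))).fn,
      fn_constH1 (polyFn (derivative q.1.2) 0),
      fn_primH1 (polyL2 (derivative (derivative q.1.2))), coeFn_polyL2 (derivative q.1.2),
      ae_restrict_mem measurableSet_Ioo] with x h1 h2 h3 h4 hx
    rw [h1, Pi.add_apply, h2, h3, h4, primitive_congr (coeFn_polyL2 _) (Ioo_subset_Icc_self hx),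
      integral_polyFn_derivative, add_sub_cancel]

/-- In the coordinates (v, c, w) the polynomial pairs fill a product of dense sets: the linear term
of V adjusts c freely without affecting V''. -/
theorem denseRange_polyH : DenseRange polyH := by
  intro u
  obtain ⟨⟨v, c, w⟩, rfl⟩ := assemble_surjective u
  have hcont : Continuous assemble := assemble.continuous
  refine closure_mono (s := assemble '' (range (fun U : oddPoly => polyL2 (derivative U.1)) ×ˢ
    (univ ×ˢ range (fun V : oddPoly => polyL2 (derivative (derivative V.1)))))) ?_ ?_
  · rintro _ ⟨⟨_, c, _⟩, ⟨⟨U, rfl⟩, -, ⟨V, rfl⟩⟩, rfl⟩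
    refine ⟨⟨(U.1, V.1 + monomial 1 (c - polyFn (derivative V.1) 0)), U.2, oddPoly.add_mem V.2
      (monomial_mem_oddPoly odd_one _)⟩, ?_⟩
    rw [polyH_eq_assemble]
    simp [polyFn]
  · refine image_closure_subset_closure_image hcont ⟨_, ?_, rfl⟩
    rw [closure_prod_eq, closure_prod_eq, closure_univ]
    refine ⟨?_, mem_univ _, ?_⟩ <;> refine Metric.mem_closure_iff.2 fun ε hε => ?_
    · obtain ⟨U, hU, h⟩ := exists_oddPoly_derivative_near v (half_pos hε)
      exact ⟨_, ⟨⟨U, hU⟩, rfl⟩, by rw [dist_eq_norm]; linarith⟩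
    · obtain ⟨V, hV, h⟩ := exists_oddPoly_derivative_derivative_near w (half_pos hε)
      exact ⟨_, ⟨⟨V, hV⟩, rfl⟩, by rw [dist_eq_norm]; linarith⟩

/-- On an invariant block of finite dimension injectivity implies surjectivity. -/
theorem exists_shiftAction_polyCD_eq {p : ℝ} (hp : 3 < p) {z : ℂ}
    (hz : 0 < z.re + 2 / (p - 1)) (hz1 : z ≠ 1) (r : oddPair) :
    ∃ q : oddPair, shiftAction p z (polyCD q) = polyH r := by
  obtain ⟨N₁, h1⟩ := exists_mem_oddLT r.2.1
  obtain ⟨N₂, h2⟩ := exists_mem_oddLT r.2.2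
  set N := max N₁ N₂
  have hr : r.1 ∈ oddPairLT N :=
    ⟨oddLT_mono (le_max_left _ _) h1, oddLT_mono (le_max_right _ _) h2⟩
  let M : oddPairLT N →ₗ[ℂ] oddPairLT N :=
    { toFun := fun q => ⟨polyAction p z q.1, polyAction_mem_oddPairLT p z q.2⟩
      map_add' := fun q q' => by
        refine Subtype.ext (Prod.ext ?_ ?_) <;>
          simp only [polyAction, Submodule.coe_add, Prod.fst_add, Prod.snd_add, derivative_add] <;>
          simp only [smul_eq_C_mul] <;> ring
      map_smul' := fun k q => by
        refine Subtype.ext (Prod.ext ?_ ?_) <;>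
          simp only [polyAction, Submodule.coe_smul, Prod.smul_fst, Prod.smul_snd,
            derivative_smul, RingHom.id_apply] <;>
          simp only [smul_eq_C_mul] <;> ring }
  have hinj : Function.Injective M := by
    rw [injective_iff_map_eq_zero]
    intro q hq
    exact Subtype.ext (eq_zero_of_polyAction_eq_zero hp hz hz1 (oddPairLT_le N q.2)
      (congrArg Subtype.val hq))
  obtain ⟨q, hq⟩ := LinearMap.injective_iff_surjective.1 hinj ⟨r.1, hr⟩
  refine ⟨⟨q.1, oddPairLT_le N q.2⟩, ?_⟩
  rw [shiftAction_polyCD]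
  exact congrArg polyH (Subtype.ext (show polyAction p z q.1 = r.1 from congrArg Subtype.val hq))

/-! ### The graph of the generator -/

/-- The graph of the free operator. -/
def freeGraph (p : ℝ) : Submodule ℂ (HSpace × HSpace) :=
  (LinearMap.range (incl.prod (freeAction p))).topologicalClosure

theorem freeOp_graph (p : ℝ) : (freeOp p).graph = freeGraph p := by
  rw [freeOp, ← (freeOpCore_isClosable p).graph_closure_eq_closure_graph, freeOpCore_graph]
  rfl

theorem mem_freeGraph (p : ℝ) (u : (generator p).domain) :
    ((u : HSpace), generator p u - perturbation p u) ∈ freeGraph p := by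
  rw [← freeOp_graph]
  have h : generator p u = perturbation p u + freeOp p ⟨u, u.2⟩ := rfl
  rw [h, add_sub_cancel_left]
  exact (freeOp p).mem_graph ⟨u, u.2⟩

theorem generator_apply_of_mem_freeGraph {p : ℝ} {w : HSpace × HSpace} (hw : w ∈ freeGraph p) :
    ∃ h : w.1 ∈ (generator p).domain, generator p ⟨w.1, h⟩ = perturbation p w.1 + w.2 := by
  rw [← freeOp_graph, LinearPMap.mem_graph_iff] at hw
  obtain ⟨y, hy, hy'⟩ := hw
  have h : w.1 ∈ (freeOp p).domain := hy ▸ y.2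
  refine ⟨h, ?_⟩
  have e : y = ⟨w.1, h⟩ := Subtype.ext hy
  have : generator p ⟨w.1, h⟩ = perturbation p w.1 + freeOp p ⟨w.1, h⟩ := rfl
  rw [this, ← hy', e]

theorem incl_mem_freeGraph (p : ℝ) (f : ClassicalDomain) : (incl f, freeAction p f) ∈ freeGraph p :=
  Submodule.le_topologicalClosure _ ⟨f, rfl⟩

/-- The map `(u, L₀ u) ↦ (z - L) u` on the graph. -/
def shiftCLM (p : ℝ) (z : ℂ) : HSpace × HSpace →L[ℂ] HSpace :=
  z • ContinuousLinearMap.fst ℂ HSpace HSpace - ContinuousLinearMap.snd ℂ HSpace HSpace -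
    (perturbationCLM p).comp (ContinuousLinearMap.fst ℂ HSpace HSpace)

theorem shiftCLM_apply (p : ℝ) (z : ℂ) (w : HSpace × HSpace) :
    shiftCLM p z w = z • w.1 - w.2 - perturbation p w.1 := rfl

theorem shiftCLM_incl (p : ℝ) (z : ℂ) (f : ClassicalDomain) :
    shiftCLM p z (incl f, freeAction p f) = shiftAction p z f := rfl

theorem norm_fst_le_of_mem_freeGraph {p : ℝ} {z : ℂ} {C : ℝ}
    (h : ∀ f, ‖incl f‖ ≤ C * ‖shiftAction p z f‖) {w : HSpace × HSpace} (hw : w ∈ freeGraph p) :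
    ‖w.1‖ ≤ C * ‖shiftCLM p z w‖ := by
  have hcl : _root_.IsClosed {w : HSpace × HSpace | ‖w.1‖ ≤ C * ‖shiftCLM p z w‖} :=
    isClosed_le (by fun_prop) (by fun_prop)
  refine closure_minimal ?_ hcl hw
  rintro _ ⟨f, rfl⟩
  exact h f

/-- The bound on u extends to the closed graph by continuity, and L₀u = zu - (z-L)u - L'u then
bounds the second coordinate. -/
theorem antilipschitz_shiftCLM {p : ℝ} {z : ℂ} {C : ℝ} (hC : 0 ≤ C)
    (h : ∀ f, ‖incl f‖ ≤ C * ‖shiftAction p z f‖) :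
    ∃ K, AntilipschitzWith K ((shiftCLM p z).comp (freeGraph p).subtypeL) := by
  set B := ‖z‖ + ‖perturbationCLM p‖ with hB
  have hB0 : 0 ≤ B := by positivity
  refine ⟨⟨C + B * C + 1, by positivity⟩, AddMonoidHomClass.antilipschitz_of_bound _ ?_⟩
  rintro ⟨w, hw⟩
  change ‖w‖ ≤ (C + B * C + 1) * ‖shiftCLM p z w‖
  have h1 := norm_fst_le_of_mem_freeGraph h hw
  have e : w.2 = z • w.1 - shiftCLM p z w - perturbation p w.1 := by
    rw [shiftCLM_apply]; abel
  have h2 : ‖w.2‖ ≤ ‖z‖ * ‖w.1‖ + ‖shiftCLM p z w‖ + ‖perturbationCLM p‖ * ‖w.1‖ := by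
    rw [e, ← norm_smul]
    exact (norm_sub_le _ _).trans (add_le_add (norm_sub_le _ _)
      ((perturbationCLM p).le_opNorm w.1))
  have h3 := mul_le_mul_of_nonneg_left h1 hB0
  have h4 : 0 ≤ B * C * ‖shiftCLM p z w‖ := by positivity
  have h5 : 0 ≤ C * ‖shiftCLM p z w‖ := by positivity
  have h6 := norm_nonneg (shiftCLM p z w)
  rw [Prod.norm_def]
  refine max_le ?_ ?_ <;> linarith

/-- On the complete graph of L₀ the map (u, L₀u) ↦ (z-L)u has closed range by the lower bound and
dense range by the polynomials. The resolvent is the first coordinate of its inverse. -/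
theorem mem_resolventSetOp_generator {p : ℝ} (hp : 3 < p) {z : ℂ}
    (hz : 0 < z.re + 2 / (p - 1)) (hz1 : z ≠ 1) : z ∈ resolventSetOp (generator p) := by
  obtain ⟨C, hC, hC'⟩ := exists_norm_incl_le hp hz hz1
  obtain ⟨K, hK⟩ := antilipschitz_shiftCLM hC hC'
  set T := (shiftCLM p z).comp (freeGraph p).subtypeL with hT
  have : CompleteSpace (freeGraph p) :=
    (Submodule.isClosed_topologicalClosure _).completeSpace_coe
  have hclosed : _root_.IsClosed (range T) := hK.isClosed_range T.uniformContinuous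
  have hdense : DenseRange T := by
    refine denseRange_polyH.mono ?_
    rintro _ ⟨r, rfl⟩
    obtain ⟨q, hq⟩ := exists_shiftAction_polyCD_eq hp hz hz1 r
    exact ⟨⟨_, incl_mem_freeGraph p (polyCD q)⟩, hq⟩
  have hsurj : Function.Surjective T := by
    rw [← range_eq_univ, ← hclosed.closure_eq, hdense.closure_range]
  set e := ContinuousLinearEquiv.ofBijective T (LinearMap.ker_eq_bot.2 hK.injective)
    (LinearMap.range_eq_top.2 hsurj) with he
  refine ⟨(ContinuousLinearMap.fst ℂ HSpace HSpace).comp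
    ((freeGraph p).subtypeL.comp (e.symm : HSpace →L[ℂ] freeGraph p)), fun f => ?_, fun u => ?_⟩
  · obtain ⟨h, h'⟩ := generator_apply_of_mem_freeGraph (e.symm f).2
    refine ⟨h, ?_⟩
    have h2 : T (e.symm f) = f := e.apply_symm_apply f
    refine Eq.trans ?_ h2
    change z • (e.symm f).1.1 - generator p ⟨(e.symm f).1.1, h⟩ =
      z • (e.symm f).1.1 - (e.symm f).1.2 - perturbation p (e.symm f).1.1
    rw [h']
    abel
  · have h : e ⟨_, mem_freeGraph p u⟩ = z • (u : HSpace) - generator p u := by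
      change z • (u : HSpace) - (generator p u - perturbation p u) - perturbation p u = _
      abel
    rw [← h]
    change (e.symm (e ⟨_, mem_freeGraph p u⟩)).1.1 = _
    rw [e.symm_apply_apply]

/-! ### The eigenvalue `1` -/

theorem symmetryMode_eq_polyH (p : ℝ) (h) :
    symmetryMode p = polyH ⟨((((p + 1) / (p - 1) : ℝ) : ℂ) • X, X), h⟩ := by
  refine HSpace.ext_fn ?_ ?_ <;> refine Lp.ext ?_
  · rw [fn_comp1_polyH]
    refine (fn_ofC1 (contDiffOn_const.mul Complex.ofRealCLM.contDiff.contDiffOn)).trans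
      (Filter.EventuallyEq.trans ?_ (coeFn_polyL2 _).symm)
    exact Filter.Eventually.of_forall fun x => by simp [polyFn]
  · rw [fn_comp2_polyH]
    refine (fn_ofC1 contDiffOn_const).trans (Filter.EventuallyEq.trans ?_ (coeFn_polyL2 _).symm)
    exact Filter.Eventually.of_forall fun x => by simp [polyFn]

theorem X_mem_oddPoly : (X : ℂ[X]) ∈ oddPoly := by
  rw [← monomial_one_one_eq_X]; exact monomial_mem_oddPoly odd_one 1

theorem symmetryPair_mem (p : ℝ) : ((((p + 1) / (p - 1) : ℝ) : ℂ) • X, X) ∈ oddPair :=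
  ⟨oddPoly.smul_mem _ X_mem_oddPoly, X_mem_oddPoly⟩

theorem symmetryMode_ne_zero (p : ℝ) : symmetryMode p ≠ 0 := by
  rw [symmetryMode_eq_polyH p (symmetryPair_mem p), ← map_zero polyH]
  intro h
  exact X_ne_zero (congrArg (fun q : oddPair => q.1.2) (polyH_injective h))

theorem polyAction_one_symmetryPair {p : ℝ} (hp : 3 < p) :
    polyAction p 1 ((((p + 1) / (p - 1) : ℝ) : ℂ) • X, X) = 0 := by
  have hp1 : p - 1 ≠ 0 := by linarith
  have e : (p + 1) / (p - 1) = 1 + 2 / (p - 1) := by field_simp; ring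
  rw [polyAction, mul_kappa hp, e]
  refine Prod.ext ?_ ?_
  · simp only [smul_eq_C_mul, derivative_mul, derivative_C, zero_mul, derivative_X,
      derivative_one, Prod.fst_zero]
    push_cast
    simp only [map_add, map_mul, map_one, map_ofNat]
    ring
  · simp only [derivative_X, Prod.snd_zero, smul_eq_C_mul]
    push_cast
    simp only [map_add, map_sub, map_one]
    ring

theorem mem_eigenspaceOp_generator_iff (p : ℝ) (z : ℂ) (u : HSpace) :
    u ∈ eigenspaceOp (generator p) z ↔ ∃ v, (u, v) ∈ freeGraph p ∧ shiftCLM p z (u, v) = 0 := by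
  constructor
  · rintro ⟨h, h'⟩
    refine ⟨_, mem_freeGraph p ⟨u, h⟩, ?_⟩
    change z • u - (generator p ⟨u, h⟩ - perturbation p u) - perturbation p u = 0
    rw [h']
    abel
  · rintro ⟨v, h, h'⟩
    obtain ⟨k, k'⟩ := generator_apply_of_mem_freeGraph h
    refine ⟨k, k'.trans ?_⟩
    rw [shiftCLM_apply, sub_sub, sub_eq_zero] at h'
    rw [h', add_comm]

theorem symmetryMode_mem_eigenspaceOp {p : ℝ} (hp : 3 < p) :
    symmetryMode p ∈ eigenspaceOp (generator p) 1 := by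
  rw [mem_eigenspaceOp_generator_iff]
  refine ⟨freeAction p (polyCD ⟨_, symmetryPair_mem p⟩), ?_, ?_⟩
  · rw [symmetryMode_eq_polyH p (symmetryPair_mem p)]
    exact incl_mem_freeGraph p _
  · rw [symmetryMode_eq_polyH p (symmetryPair_mem p)]
    refine (shiftCLM_incl p 1 _).trans ?_
    rw [shiftAction_polyCD, ← map_zero polyH]
    exact congrArg polyH (Subtype.ext (polyAction_one_symmetryPair hp))

/-- In the right half plane every eigenfunction of the generator is a pair of polynomials. -/
theorem exists_eq_polyH_of_mem_eigenspaceOp {p : ℝ} {z : ℂ} (hz : 0 ≤ z.re + 2 / (p - 1))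
    {u : HSpace} (hu : u ∈ eigenspaceOp (generator p) z) : ∃ q : oddPair, u = polyH q := by
  obtain ⟨N, hN⟩ := exists_oddPairLT_near p
  obtain ⟨v, hv, hv0⟩ := (mem_eigenspaceOp_generator_iff p z u).1 hu
  set Q : Submodule ℂ HSpace :=
    LinearMap.range (polyH ∘ₗ Submodule.inclusion (oddPairLT_le N)) with hQ
  have hQc : _root_.IsClosed (Q : Set HSpace) := Q.closed_of_finiteDimensional
  have hmem : u ∈ closure (Q : Set HSpace) := by
    rw [Metric.mem_closure_iff]
    intro ε hε
    -- The functional vanishes at (u, v), which lies in the closure of the classical graph. So some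
    -- classical f is close to u with (z-L)f small, and its polynomial approximant of degree less
    -- than N is within ε of u. As N does not depend on ε, u is in the closed space Q.
    have hcont : Continuous fun w : HSpace × HSpace => ‖u - w.1‖ + 12 * ‖shiftCLM p z w‖ := by
      fun_prop
    have hopen : IsOpen {w : HSpace × HSpace | ‖u - w.1‖ + 12 * ‖shiftCLM p z w‖ < ε} :=
      isOpen_lt hcont continuous_const
    obtain ⟨_, hw, ⟨f, rfl⟩⟩ := mem_closure_iff.1 hv _ hopen (by simpa [hv0] using hε)
    obtain ⟨q, hq, hqf⟩ := hN z hz f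
    refine ⟨polyH q, ⟨⟨q.1, hq⟩, rfl⟩, ?_⟩
    have hw' : ‖u - incl f‖ + 12 * ‖shiftAction p z f‖ < ε := hw
    rw [dist_eq_norm, ← sub_add_sub_cancel u (incl f)]
    exact (norm_add_le _ _).trans_lt (by linarith)
  rw [hQc.closure_eq] at hmem
  obtain ⟨q, hq⟩ := hmem
  exact ⟨_, hq.symm⟩

theorem eigenspaceOp_generator_one {p : ℝ} (hp : 3 < p) :
    eigenspaceOp (generator p) 1 = Submodule.span ℂ {symmetryMode p} := by
  have ha0 : 0 < 2 / (p - 1) := div_pos two_pos (by linarith)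
  refine le_antisymm (fun u hu => ?_) ?_
  · obtain ⟨q, rfl⟩ := exists_eq_polyH_of_mem_eigenspaceOp (by simpa using by linarith) hu
    obtain ⟨v, hv, hv0⟩ := (mem_eigenspaceOp_generator_iff p 1 _).1 hu
    -- The closed graph is single-valued, so at a polynomial pair L₀ acts classically and the
    -- recursion applies.
    have hfree : v = freeAction p (polyCD q) := by
      rw [← sub_eq_zero]
      refine eq_zero_of_mem_closure p (w := (polyH q, v) - (incl (polyCD q), freeAction p (polyCD q)))
        ((freeGraph p).sub_mem hv (incl_mem_freeGraph p _)) (sub_self _)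
    have h0 : polyH ⟨polyAction p 1 q, polyAction_mem_oddPair p 1 q.2⟩ = 0 := by
      rw [← shiftAction_polyCD, ← hv0, hfree]
      rfl
    rw [← map_zero polyH] at h0
    obtain ⟨k, hk⟩ := exists_eq_of_polyAction_one_eq_zero hp q.2
      (congrArg Subtype.val (polyH_injective h0))
    refine Submodule.mem_span_singleton.2 ⟨k, ?_⟩
    rw [symmetryMode_eq_polyH p (symmetryPair_mem p), ← map_smul]
    exact congrArg polyH (Subtype.ext hk.symm)
  · rw [Submodule.span_singleton_le_iff_mem]
    exact symmetryMode_mem_eigenspaceOp hp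

theorem mem_spectrumOp_of_mem_pointSpectrumOp {E : Type*} [NormedAddCommGroup E] [NormedSpace ℂ E]
    {A : E →ₗ.[ℂ] E} {z : ℂ} (h : z ∈ pointSpectrumOp A) : z ∈ spectrumOp A := by
  rintro ⟨R, -, hR⟩
  obtain ⟨u, ⟨hu, hu'⟩, hu0⟩ := h
  have := hR ⟨u, hu⟩
  rw [hu', sub_self, map_zero] at this
  exact hu0 this.symm

end BlowupStability

end

theorem lemma2p3 (p : ℝ) (hp : 3 < p) :
    BlowupStability.spectrumOp (BlowupStability.generator p) ⊆
        {z : ℂ | z.re ≤ -(2 / (p - 1))} ∪ {1} ∧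
      (1 : ℂ) ∈ BlowupStability.spectrumOp (BlowupStability.generator p) ∧
      (1 : ℂ) ∈ BlowupStability.pointSpectrumOp (BlowupStability.generator p) ∧
      BlowupStability.eigenspaceOp (BlowupStability.generator p) 1 =
        Submodule.span ℂ {BlowupStability.symmetryMode p} ∧
      Module.finrank ℂ (BlowupStability.eigenspaceOp (BlowupStability.generator p) 1) = 1 := by
  have hpt : (1 : ℂ) ∈ BlowupStability.pointSpectrumOp (BlowupStability.generator p) :=
    ⟨_, BlowupStability.symmetryMode_mem_eigenspaceOp hp, BlowupStability.symmetryMode_ne_zero p⟩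
  refine ⟨fun z hz => ?_, BlowupStability.mem_spectrumOp_of_mem_pointSpectrumOp hpt, hpt,
    BlowupStability.eigenspaceOp_generator_one hp, ?_⟩
  · by_contra hcon
    rw [mem_union, not_or, mem_ofPred_eq, not_le] at hcon
    exact hz (BlowupStability.mem_resolventSetOp_generator hp (by linarith [hcon.1]) hcon.2)
  · rw [BlowupStability.eigenspaceOp_generator_one hp]
    exact finrank_span_singleton (BlowupStability.symmetryMode_ne_zero p)
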